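/- For a permutation $\sigma$ of $\{1,\dots,n\}$, an interval is a set of contiguous indices whose set of values is also contiguous; $\sigma$ is simple if $n\ge 2$ and its only intervals have length $0$, $1$ or $n$. It avoids $123$ if there are no $i<j<k$ with $\sigma(i)<\sigma(j)<\sigma(k)$. Write $\operatorname{lrmin}(\sigma)$ for its number of left-to-right minima (entries smaller than everything to their left), $\operatorname{rlmax}(\sigma)$ for its number of right-to-left maxima (entries larger than everything to their right). For $i\in\{0,1,2\}$ let $\mathcal S_i$ be the set of simple $123$-avoiding involutions of length at least four with exactly $i$ fixed points, and put, as formal power series, $$s^{(i)}(x)=\sum_{\sigma\in\mathcal S_i}x^{|\sigma|}\quad(i=0,1,2),\qquad \widehat s^{(i)}(u,v)=\sum_{\sigma\in\mathcal S_i}u^{\operatorname{lrmin}(\sigma)}v^{\operatorname{rlmax}(\sigma)}\quad(i=0,2),$$ while $\widehat s^{(1)}(u,v)$ is the sum of $u^{\operatorname{lrmin}(\sigma)}v^{\operatorname{rlmax}(\sigma)}$ over only those $\sigma\in\mathcal S_1$ whose fixed point is a right-to-left maximum. Let $q=\sqrt{1-2x^2-3x^4}$ and $r=\sqrt{1-6u^2v^2-4u^2v^4-4u^4v^2-3u^4v^4}$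 be the formal power series square roots with constant term $1$. Then $$s^{(0)}(x)=\frac{2x^6(1+x^2-q)}{2-2x^2-10x^4-6x^6+(2-6x^4-4x^6)q},$$ $$s^{(1)}(x)=\frac{2x^5(1+x^2+q)}{(1+x^2)^2\left(1-3x^2+(1-2x^2)q\right)},$$ $$s^{(2)}(x)=\frac{x^4\left(2+5x^2+3x^4-(2+x^2)q\right)}{1-x^2-5x^4-3x^6+(1+2x^2+x^4)q},$$ and $$\widehat s^{(0)}(u,v)=\frac{2u^2v^4(1+u^2)(1+2u^2+u^2v^2-r)}{(1-u^2v^2+r)\left(1-6u^2v^2-4u^2v^4-4u^4v^2-3u^4v^4+(1+2v^2+u^2v^2)r\right)},$$ $$\widehat s^{(1)}(u,v)=\frac{u^2v^3(1+u^2)(1+2v^2+u^2v^2+r)}{(1+v^2)\left(1-6u^2v^2-4u^2v^4-4u^4v^2-3u^4v^4+(1-3u^2v^2-2u^4v^2)r\right)},$$ $$\widehat s^{(2)}(u,v)=\frac{uv^3\left(2+7u^2+4u^2v^2+4u^4+3u^4v^2-(2+u^2)r\right)}{1-6u^2v^2-4u^2v^4-4u^4v^2-3u^4v^4+(1+2v^2+u^2v^2)r}.$$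 Moreover, the sum of $u^{\operatorname{lrmin}(\sigma)}v^{\operatorname{rlmax}(\sigma)}$ over those $\sigma\in\mathcal S_1$ whose fixed point is a left-to-right minimum is $\widehat s^{(1)}(v,u)$, and the sum over all of $\mathcal S_1$ is $\widehat s^{(1)}(u,v)+\widehat s^{(1)}(v,u)$. -/

import Mathlib

namespace SimpleAvInv

/-- `σ` contains no increasing subsequence of length three. -/
def Avoids123 {n : ℕ} (σ : Equiv.Perm (Fin n)) : Prop :=
  ∀ i j k : Fin n, i < j → j < k → ¬ (σ i < σ j ∧ σ j < σ k)

/-- An interval of `σ`: a contiguous set of indices whose set of values is also contiguous. -/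
def IsInterval {n : ℕ} (σ : Equiv.Perm (Fin n)) (I : Set (Fin n)) : Prop :=
  I.OrdConnected ∧ (σ '' I).OrdConnected

/-- A permutation of length at least two whose only intervals have length `0`, `1` or `n`. -/
def IsSimple {n : ℕ} (σ : Equiv.Perm (Fin n)) : Prop :=
  2 ≤ n ∧ ∀ I : Set (Fin n), IsInterval σ I → I.Subsingleton ∨ I = Set.univ

/-- The entry at index `i` is smaller than all entries to its left. -/
def IsLRMin {n : ℕ} (σ : Equiv.Perm (Fin n)) (i : Fin n) : Prop :=
  ∀ j : Fin n, j < i → σ i < σ j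

/-- The entry at index `i` is larger than all entries to its right. -/
def IsRLMax {n : ℕ} (σ : Equiv.Perm (Fin n)) (i : Fin n) : Prop :=
  ∀ j : Fin n, i < j → σ j < σ i

/-- The number of left-to-right minima. -/
noncomputable def lrmin {n : ℕ} (σ : Equiv.Perm (Fin n)) : ℕ :=
  {i : Fin n | IsLRMin σ i}.ncard

/-- The number of right-to-left maxima. -/
noncomputable def rlmax {n : ℕ} (σ : Equiv.Perm (Fin n)) : ℕ :=
  {i : Fin n | IsRLMax σ i}.ncard

/-- The number of fixed points. -/
noncomputable def fp {n : ℕ} (σ : Equiv.Perm (Fin n)) : ℕ :=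
  {i : Fin n | σ i = i}.ncard

/-- `σ` is a simple `123`-avoiding involution of length at least four. -/
def IsSimpleAvInv {n : ℕ} (σ : Equiv.Perm (Fin n)) : Prop :=
  4 ≤ n ∧ IsSimple σ ∧ Avoids123 σ ∧ Function.Involutive σ

/-- Simple `123`-avoiding involutions (of any length at least four) with `i` fixed points. -/
def family (i : ℕ) : Set (Σ n : ℕ, Equiv.Perm (Fin n)) :=
  {p | IsSimpleAvInv p.2 ∧ fp p.2 = i}

/-- Those with exactly one fixed point, this fixed point being a right-to-left maximum. -/
def familyRL : Set (Σ n : ℕ, Equiv.Perm (Fin n)) :=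
  {p | p ∈ family 1 ∧ ∀ i : Fin p.1, p.2 i = i → IsRLMax p.2 i}

/-- Those with exactly one fixed point, this fixed point being a left-to-right minimum. -/
def familyLR : Set (Σ n : ℕ, Equiv.Perm (Fin n)) :=
  {p | p ∈ family 1 ∧ ∀ i : Fin p.1, p.2 i = i → IsLRMin p.2 i}

/-- The generating function by length: the coefficient of `x ^ n` is the number of simple
`123`-avoiding involutions of length `n` (at least four) with `i` fixed points. -/
noncomputable def lengthGF (i : ℕ) : PowerSeries ℚ :=
  PowerSeries.mk fun n =>
    (({σ : Equiv.Perm (Fin n) | IsSimpleAvInv σ ∧ fp σ = i}.ncard : ℕ) : ℚ)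

/-- The generating function of a set `S` of permutations in the variables `u` (index `0`) and
`v` (index `1`): the coefficient of `u ^ a * v ^ b` is the number of members of `S` with `a`
left-to-right minima and `b` right-to-left maxima. -/
noncomputable def bivGF (S : Set (Σ n : ℕ, Equiv.Perm (Fin n))) : MvPowerSeries (Fin 2) ℚ :=
  fun m => (({p | p ∈ S ∧ lrmin p.2 = m 0 ∧ rlmax p.2 = m 1}.ncard : ℕ) : ℚ)

/-- In a `123`-avoiding permutation every entry is a left-to-right minimum or a right-to-left
maximum, so that the length is bounded by the two statistics. -/
theorem length_le {n : ℕ} {σ : Equiv.Perm (Fin n)} (h : Avoids123 σ) :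
    n ≤ lrmin σ + rlmax σ := by
  have hu : ({i : Fin n | IsLRMin σ i} ∪ {i : Fin n | IsRLMax σ i}) = Set.univ := by
    ext i
    simp only [Set.mem_union, Set.mem_ofPred_eq, Set.mem_univ, iff_true]
    by_contra hc
    simp only [IsLRMin, IsRLMax] at hc
    push Not at hc
    obtain ⟨⟨j, hj, hj'⟩, k, hk, hk'⟩ := hc
    exact h j i k hj hk
      ⟨lt_of_le_of_ne hj' (fun e => hj.ne (σ.injective e)),
        lt_of_le_of_ne hk' (fun e => hk.ne (σ.injective e))⟩
  have := Set.ncard_union_le {i : Fin n | IsLRMin σ i} {i : Fin n | IsRLMax σ i}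
  rw [hu, Set.ncard_univ, Nat.card_eq_fintype_card, Fintype.card_fin] at this
  exact this

/-- The sets counted by `bivGF` are finite for every family used here, so that their `ncard` is
their true number of elements. -/
theorem finite_family (i a b : ℕ) :
    {p | p ∈ family i ∧ lrmin p.2 = a ∧ rlmax p.2 = b}.Finite := by
  have hf : (Set.range fun q : (Σ n : Fin (a + b + 1), Equiv.Perm (Fin n)) =>
      (⟨q.1, q.2⟩ : Σ n : ℕ, Equiv.Perm (Fin n))).Finite := Set.finite_range _
  refine hf.subset ?_
  rintro ⟨n, σ⟩ ⟨⟨⟨_, _, h, _⟩, _⟩, ha, hb⟩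
  have hn : n ≤ lrmin σ + rlmax σ := length_le h
  have ha : lrmin σ = a := ha
  have hb : rlmax σ = b := hb
  exact ⟨⟨⟨n, by omega⟩, σ⟩, rfl⟩

end SimpleAvInv

namespace SimpleAvInv

/-- The number of `true` letters among the first `i` letters stays, together with the number among
the first `w.length - i` letters, below the total number increased by `d`. -/
def Above (d : ℕ) (w : List Bool) : Prop :=
  ∀ i ≤ w.length, (w.take i).count true + (w.take (w.length - i)).count true < d + w.count true

/-- Words of skew-indecomposable `123`-avoiding involutions of length at least two. -/
def Indec (w : List Bool) : Prop :=
  2 ≤ w.length ∧ ∀ i, 0 < i → i < w.length →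
    (w.take i).count true + (w.take (w.length - i)).count true < w.count true

/-- The words with `p` letters `false` and `q` letters `true` satisfying `P`. -/
def wordSet (P : List Bool → Prop) (p q : ℕ) : Set (List Bool) :=
  {w | P w ∧ w.count false = p ∧ w.count true = q}

/-- The number of words with `p` letters `false` and `q` letters `true` satisfying `P`. -/
noncomputable def num (P : List Bool → Prop) (p q : ℕ) : ℕ := (wordSet P p q).ncard

theorem count_false_add_count_true (w : List Bool) :
    w.count false + w.count true = w.length := List.count_false_add_count_true w

theorem mem_wordSet {P : List Bool → Prop} {p q : ℕ} {w : List Bool} :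
    w ∈ wordSet P p q ↔ P w ∧ w.count false = p ∧ w.count true = q := Iff.rfl

theorem wordSet_finite (P : List Bool → Prop) (p q : ℕ) : (wordSet P p q).Finite := by
  refine (List.finite_length_eq Bool (p + q)).subset ?_
  rintro w ⟨-, rfl, rfl⟩
  exact (count_false_add_count_true w).symm

theorem num_congr {P Q : List Bool → Prop} {p q : ℕ}
    (h : ∀ w, w.count false = p → w.count true = q → (P w ↔ Q w)) : num P p q = num Q p q := by
  unfold num
  congr 1
  ext w
  simp only [wordSet, Set.mem_ofPred_eq]
  constructor
  · rintro ⟨h1, h2, h3⟩; exact ⟨(h w h2 h3).1 h1, h2, h3⟩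
  · rintro ⟨h1, h2, h3⟩; exact ⟨(h w h2 h3).2 h1, h2, h3⟩

theorem exists_ends {w : List Bool} (h : 2 ≤ w.length) : ∃ a z b, w = a :: (z ++ [b]) := by
  obtain _ | ⟨a, t⟩ := w
  · simp at h
  · have ht : t ≠ [] := by rintro rfl; simp at h
    exact ⟨a, t.dropLast, t.getLast ht, by rw [List.dropLast_append_getLast]⟩

theorem above_ends {d : ℕ} {a b : Bool} {z : List Bool} :
    Above d (a :: (z ++ [b])) ↔ 0 < d ∧ Above (d + b.toNat - a.toNat) z := by
  have key : ∀ i ≤ z.length, (List.take (i + 1) (a :: (z ++ [b]))).count true =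
      a.toNat + (z.take i).count true := by
    intro i hi
    rw [List.take_succ_cons, List.take_append_of_le_length hi]
    cases a <;> simp [add_comm]
  have tot : (a :: (z ++ [b])).count true = a.toNat + z.count true + b.toNat := by
    cases a <;> cases b <;> simp [add_comm]
  have ha : a.toNat ≤ 1 := by cases a <;> simp
  constructor
  · intro h
    have h0 : 0 < d := by
      have := h 0 (by simp)
      rw [Nat.sub_zero, List.take_length, List.take_zero, List.count_nil] at this
      omega
    refine ⟨h0, fun i hi => ?_⟩
    have := h (i + 1) (by simp; omega)
    rw [show (a :: (z ++ [b])).length - (i + 1) = (z.length - i) + 1 by simp; omega, key i hi,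
      key _ (by omega), tot] at this
    omega
  · rintro ⟨h0, h⟩ i hi
    rcases Nat.eq_zero_or_pos i with rfl | hi0
    · rw [Nat.sub_zero, List.take_length, List.take_zero, List.count_nil]
      omega
    rcases Nat.lt_or_ge i (a :: (z ++ [b])).length with hlt | hge
    · obtain ⟨j, rfl⟩ : ∃ j, i = j + 1 := ⟨i - 1, by omega⟩
      simp only [List.length_cons, List.length_append, List.length_nil] at hlt
      have := h j (by omega)
      rw [show (a :: (z ++ [b])).length - (j + 1) = (z.length - j) + 1 by simp; omega,
        key j (by omega), key _ (by omega), tot]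
      omega
    · rw [List.take_of_length_le hge, Nat.sub_eq_zero_of_le hge]
      simp [h0]

theorem not_above_zero (w : List Bool) : ¬ Above 0 w := fun h => by simpa using h 0 (by simp)

theorem above_nil {d : ℕ} : Above d [] ↔ 0 < d := by simp [Above]

theorem above_singleton {d : ℕ} {a : Bool} : Above d [a] ↔ 0 < d := by
  constructor
  · intro h
    simpa using h 0 (by simp)
  · intro h i hi
    rcases Nat.le_one_iff_eq_zero_or_eq_one.1 (show i ≤ 1 from hi) with rfl | rfl <;> simp [h]

theorem indec_iff_ends {w : List Bool} :
    Indec w ↔ ∃ z, w = false :: (z ++ [true]) ∧ Above 1 z := by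
  constructor
  · rintro ⟨h2, h⟩
    obtain ⟨a, z, b, rfl⟩ := exists_ends h2
    have key : ∀ i ≤ z.length, (List.take (i + 1) (a :: (z ++ [b]))).count true =
        a.toNat + (z.take i).count true := by
      intro i hi
      rw [List.take_succ_cons, List.take_append_of_le_length hi]
      cases a <;> simp [add_comm]
    have tot : (a :: (z ++ [b])).count true = a.toNat + z.count true + b.toNat := by
      cases a <;> cases b <;> simp [add_comm]
    have hk : ∀ i ≤ z.length, a.toNat + (z.take i).count true +
        (a.toNat + (z.take (z.length - i)).count true) < a.toNat + z.count true + b.toNat := by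
      intro i hi
      have := h (i + 1) (by omega) (by simp; omega)
      rwa [show (a :: (z ++ [b])).length - (i + 1) = (z.length - i) + 1 by simp; omega, key i hi,
        key _ (by omega), tot] at this
    have h0 := hk 0 (by omega)
    obtain ⟨rfl, rfl⟩ : a = false ∧ b = true := by
      cases a <;> cases b <;> simp at h0 ⊢ 
    refine ⟨z, rfl, fun i hi => ?_⟩
    have := hk i hi
    simp only [Bool.toNat_false, Bool.toNat_true] at this
    omega
  · rintro ⟨z, rfl, h⟩
    refine ⟨by simp, fun i h0 hi => ?_⟩
    obtain ⟨j, rfl⟩ : ∃ j, i = j + 1 := ⟨i - 1, by omega⟩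
    simp only [List.length_cons, List.length_append, List.length_nil] at hi
    have := h j (by omega)
    rw [show (false :: (z ++ [true])).length - (j + 1) = (z.length - j) + 1 by simp; omega,
      List.take_succ_cons, List.take_succ_cons, List.take_append_of_le_length (by omega),
      List.take_append_of_le_length (by omega)]
    simp
    omega

theorem num_indec_succ (p q : ℕ) : num Indec (p + 1) (q + 1) = num (Above 1) p q := by
  unfold num
  have hinj : Function.Injective fun z : List Bool => false :: (z ++ [true]) := by
    intro x y h
    simpa using h
  rw [← Set.ncard_image_of_injective (wordSet (Above 1) p q) hinj]
  congr 1
  ext w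
  simp only [mem_wordSet, Set.mem_image, indec_iff_ends]
  constructor
  · rintro ⟨⟨z, rfl, hz⟩, h1, h2⟩
    exact ⟨z, ⟨hz, by simpa using h1, by simpa using h2⟩, rfl⟩
  · rintro ⟨z, ⟨hz, h1, h2⟩, rfl⟩
    exact ⟨⟨z, rfl, hz⟩, by simpa using h1, by simpa using h2⟩

theorem ncard_eq_ends {S : Set (List Bool)} (hS : S.Finite) :
    S.ncard = {w | w ∈ S ∧ w.length ≤ 1}.ncard + ({z | false :: (z ++ [false]) ∈ S}.ncard +
      {z | false :: (z ++ [true]) ∈ S}.ncard + ({z | true :: (z ++ [false]) ∈ S}.ncard +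
      {z | true :: (z ++ [true]) ∈ S}.ncard)) := by
  have hinj : ∀ a b : Bool, Function.Injective fun z : List Bool => a :: (z ++ [b]) := by
    intro a b x y h
    simpa using h
  have hsub : ∀ a b : Bool, (fun z : List Bool => a :: (z ++ [b])) '' {z | a :: (z ++ [b]) ∈ S}
      ⊆ S := by
    rintro a b _ ⟨z, hz, rfl⟩
    exact hz
  have hfin : ∀ a b : Bool, ((fun z : List Bool => a :: (z ++ [b])) ''
      {z | a :: (z ++ [b]) ∈ S}).Finite := fun a b => hS.subset (hsub a b)
  have hdec : S = {w | w ∈ S ∧ w.length ≤ 1} ∪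
      (((fun z => false :: (z ++ [false])) '' {z | false :: (z ++ [false]) ∈ S} ∪
      (fun z => false :: (z ++ [true])) '' {z | false :: (z ++ [true]) ∈ S}) ∪
      ((fun z => true :: (z ++ [false])) '' {z | true :: (z ++ [false]) ∈ S} ∪
      (fun z => true :: (z ++ [true])) '' {z | true :: (z ++ [true]) ∈ S})) := by
    ext w
    constructor
    · intro hw
      rcases Nat.lt_or_ge 1 w.length with h | h
      · right
        obtain ⟨a, z, b, rfl⟩ := exists_ends h
        cases a <;> cases b <;> simp [hw]
      · exact Or.inl ⟨hw, h⟩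
    · rintro (h | (h | h) | (h | h))
      · exact h.1
      all_goals exact hsub _ _ h
  conv_lhs => rw [hdec]
  rw [Set.ncard_union_eq _ (hS.subset fun w h => h.1)
      (((hfin _ _).union (hfin _ _)).union ((hfin _ _).union (hfin _ _))),
    Set.ncard_union_eq _ ((hfin _ _).union (hfin _ _)) ((hfin _ _).union (hfin _ _)),
    Set.ncard_union_eq _ (hfin _ _) (hfin _ _), Set.ncard_union_eq _ (hfin _ _) (hfin _ _)]
  · simp only [Set.ncard_image_of_injective _ (hinj _ _)]
  all_goals
    rw [Set.disjoint_left]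
  · rintro _ ⟨x, -, rfl⟩ ⟨y, -, h⟩
    simpa using congrArg (fun l : List Bool => l.reverse.head?) h
  · rintro _ ⟨x, -, rfl⟩ ⟨y, -, h⟩
    simpa using congrArg (fun l : List Bool => l.reverse.head?) h
  · rintro _ (⟨x, -, rfl⟩ | ⟨x, -, rfl⟩) (⟨y, -, h⟩ | ⟨y, -, h⟩) <;> simp at h
  · rintro _ ⟨-, hl⟩ ((⟨x, -, rfl⟩ | ⟨x, -, rfl⟩) | (⟨x, -, rfl⟩ | ⟨x, -, rfl⟩)) <;> simp at hl

theorem wordSet_above_ends (d p q : ℕ) (a b : Bool) (P : List Bool → Prop)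
    (hP : ∀ z, P (a :: (z ++ [b])) ↔ Above (d + b.toNat - a.toNat) z) :
    {z | a :: (z ++ [b]) ∈ wordSet P p q}.ncard =
      if 2 - a.toNat - b.toNat ≤ p ∧ a.toNat + b.toNat ≤ q then
        num (Above (d + b.toNat - a.toNat)) (p - (2 - a.toNat - b.toNat)) (q - (a.toNat + b.toNat))
      else 0 := by
  have hc : ∀ z : List Bool, (a :: (z ++ [b])).count false =
      z.count false + (2 - a.toNat - b.toNat) := by
    intro z; cases a <;> cases b <;> simp
  have hd : ∀ z : List Bool, (a :: (z ++ [b])).count true =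
      z.count true + (a.toNat + b.toNat) := by
    intro z; cases a <;> cases b <;> simp
  split_ifs with h
  · unfold num
    congr 1
    ext z
    change a :: (z ++ [b]) ∈ wordSet P p q ↔ _
    simp only [mem_wordSet, hP, hc, hd]
    refine and_congr Iff.rfl ?_
    omega
  · convert Set.ncard_empty (List Bool) using 2
    ext z
    change a :: (z ++ [b]) ∈ wordSet P p q ↔ _
    simp only [mem_wordSet, hc, hd, Set.mem_empty_iff_false, iff_false]
    omega

theorem num_above_rec (d p q : ℕ) :
    num (Above (d + 1)) p q = (if p + q ≤ 1 then 1 else 0) +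
      ((if 2 ≤ p then num (Above (d + 1)) (p - 2) q else 0) +
      (if 1 ≤ p ∧ 1 ≤ q then num (Above (d + 2)) (p - 1) (q - 1) else 0) +
      ((if 1 ≤ p ∧ 1 ≤ q then num (Above d) (p - 1) (q - 1) else 0) +
      (if 2 ≤ q then num (Above (d + 1)) p (q - 2) else 0))) := by
  have h := fun a b : Bool => wordSet_above_ends (d + 1) p q a b (Above (d + 1)) (by
    intro z
    rw [above_ends]
    simp)
  unfold num at h ⊢
  rw [ncard_eq_ends (wordSet_finite _ _ _), h, h, h, h]
  have h0 : {w | w ∈ wordSet (Above (d + 1)) p q ∧ w.length ≤ 1}.ncard =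
      if p + q ≤ 1 then 1 else 0 := by
    split_ifs with hpq
    · have : ({w | w ∈ wordSet (Above (d + 1)) p q ∧ w.length ≤ 1} : Set (List Bool)) =
          {List.replicate p false ++ List.replicate q true} := by
        ext w
        change _ ∧ _ ↔ w = _
        rw [mem_wordSet]
        constructor
        · rintro ⟨⟨-, rfl, rfl⟩, hl⟩
          match w, hl with
          | [], _ => rfl
          | [true], _ => rfl
          | [false], _ => rfl
        · rintro rfl
          obtain ⟨rfl, rfl⟩ | ⟨rfl, rfl⟩ | ⟨rfl, rfl⟩ :
              (p = 0 ∧ q = 0) ∨ (p = 0 ∧ q = 1) ∨ (p = 1 ∧ q = 0) := by omega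
          all_goals simp [above_nil, above_singleton]
      rw [this, Set.ncard_singleton]
    · convert Set.ncard_empty (List Bool) using 2
      ext w
      change _ ∧ _ ↔ _
      simp only [mem_wordSet, Set.mem_empty_iff_false, iff_false]
      rintro ⟨⟨-, rfl, rfl⟩, hl⟩
      rw [count_false_add_count_true] at hpq
      exact hpq hl
  rw [h0]
  simp

end SimpleAvInv

namespace SimpleAvInv

/-- The letter `x` occurs in `w` preceded by exactly `k` other letters `!x`. -/
def Occ (x : Bool) (w : List Bool) (k : ℕ) : Prop :=
  ∃ u v, w = u ++ x :: v ∧ u.count (!x) = k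

/-- For no two letters `!x` consecutive in `w` are both they and their mirror images adjacent. -/
def Reduced (x : Bool) (w : List Bool) : Prop :=
  ∀ k, 0 < k → k < w.count (!x) → Occ x w k ∨ Occ x w (w.count (!x) - k)

theorem occ_nil {x : Bool} {k : ℕ} : ¬ Occ x [] k := by
  rintro ⟨u, v, h, -⟩
  simp at h

theorem occ_append {x : Bool} {w z : List Bool} {k : ℕ} :
    Occ x (w ++ z) k ↔ Occ x w k ∨ ∃ j, k = w.count (!x) + j ∧ Occ x z j := by
  constructor
  · rintro ⟨u, v, h, rfl⟩
    rcases List.append_eq_append_iff.1 h with ⟨a, rfl, rfl⟩ | ⟨a, rfl, h2⟩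
    · exact Or.inr ⟨a.count (!x), by simp, a, v, rfl, rfl⟩
    · obtain _ | ⟨y, a⟩ := a
      · refine Or.inr ⟨0, by simp, [], v, by simpa using h2.symm, rfl⟩
      · obtain ⟨rfl, rfl⟩ : x = y ∧ v = a ++ z := by simpa using h2
        exact Or.inl ⟨u, a, rfl, rfl⟩
  · rintro (⟨u, v, rfl, rfl⟩ | ⟨j, rfl, u, v, rfl, rfl⟩)
    · exact ⟨u, v ++ z, by simp, rfl⟩
    · exact ⟨w ++ u, v, by simp, by simp⟩

theorem occ_singleton {x y : Bool} {k : ℕ} : Occ x [y] k ↔ x = y ∧ k = 0 := by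
  constructor
  · rintro ⟨_ | ⟨a, u⟩, v, h, rfl⟩
    · simp at h
      simp [h]
    · simp at h
  · rintro ⟨rfl, rfl⟩
    exact ⟨[], [], rfl, rfl⟩

theorem occ_cons {x y : Bool} {w : List Bool} {k : ℕ} :
    Occ x (y :: w) k ↔ (x = y ∧ k = 0) ∨ ∃ j, k = [y].count (!x) + j ∧ Occ x w j := by
  rw [← List.singleton_append, occ_append, occ_singleton]

theorem occ_replicate {x y : Bool} {n k : ℕ} :
    Occ x (List.replicate n y) k ↔ x = y ∧ 0 < n ∧ k = 0 := by
  constructor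
  · rintro ⟨u, v, h, rfl⟩
    have hx : x ∈ List.replicate n y := by rw [h]; simp
    obtain ⟨hn, rfl⟩ := List.mem_replicate.1 hx
    refine ⟨rfl, Nat.pos_of_ne_zero hn, ?_⟩
    rw [List.count_eq_zero]
    intro hm
    have : (!x) ∈ List.replicate n x := by rw [h]; simp [hm]
    have := (List.mem_replicate.1 this).2
    cases x <;> simp at this
  · rintro ⟨rfl, hn, rfl⟩
    obtain ⟨m, rfl⟩ : ∃ m, n = m + 1 := ⟨n - 1, by omega⟩
    exact ⟨[], List.replicate m x, by simp [List.replicate_succ], rfl⟩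

theorem Occ.le_count {x : Bool} {w : List Bool} {k : ℕ} (h : Occ x w k) : k ≤ w.count (!x) := by
  obtain ⟨u, v, rfl, rfl⟩ := h
  simp

/-- The word of the polyomino transposed. -/
def dual (w : List Bool) : List Bool := (w.map not).reverse

theorem dual_dual (w : List Bool) : dual (dual w) = w := by
  simp [dual, Function.comp_def]

theorem count_map_not (x : Bool) (w : List Bool) : (w.map not).count x = w.count (!x) := by
  have := List.count_map_of_injective w not (fun a b h => by simpa using h) (!x)
  simpa using this

theorem count_dual (x : Bool) (w : List Bool) : (dual w).count x = w.count (!x) := by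
  rw [dual, List.count_reverse, count_map_not]

theorem length_dual (w : List Bool) : (dual w).length = w.length := by simp [dual]

theorem Occ.to_dual {x : Bool} {w : List Bool} {k : ℕ} (h : Occ x w k) :
    Occ (!x) (dual w) (w.count (!x) - k) := by
  obtain ⟨u, v, rfl, rfl⟩ := h
  refine ⟨dual v, dual u, by simp [dual], ?_⟩
  rw [count_dual]
  simp

theorem Reduced.to_dual {x : Bool} {w : List Bool} (h : Reduced x w) :
    Reduced (!x) (dual w) := by
  intro k h0 hk
  rw [count_dual, Bool.not_not] at hk ⊢
  rcases h k h0 hk with h | h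
  · exact Or.inr h.to_dual
  · left
    have := h.to_dual
    rwa [Nat.sub_sub_self hk.le] at this

theorem reduced_dual {x : Bool} {w : List Bool} : Reduced x (dual w) ↔ Reduced (!x) w := by
  constructor
  · intro h
    simpa [dual_dual] using h.to_dual
  · intro h
    simpa using h.to_dual

theorem count_true_take_dual (w : List Bool) {i : ℕ} (hi : i ≤ w.length) :
    ((dual w).take i).count true + (w.length - i) =
      w.count false + (w.take (w.length - i)).count true := by
  have h1 : (dual w).take i = dual (w.drop (w.length - i)) := by
    rw [dual, List.take_reverse, List.length_map, dual, List.map_drop]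
  rw [h1, count_dual]
  have h2 := congrArg (List.count false) (List.take_append_drop (w.length - i) w)
  rw [List.count_append] at h2
  have h3 := count_false_add_count_true (w.take (w.length - i))
  rw [List.length_take] at h3
  simp only [Bool.not_true]
  omega

theorem Indec.to_dual {w : List Bool} (h : Indec w) : Indec (dual w) := by
  obtain ⟨h2, h⟩ := h
  refine ⟨by rwa [length_dual], fun i h0 hi => ?_⟩
  rw [length_dual] at hi
  have e1 := count_true_take_dual w (i := i) hi.le
  have e2 := count_true_take_dual w (i := w.length - i) (by omega)
  have e3 := h i h0 hi
  have e4 := count_false_add_count_true w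
  rw [length_dual, count_dual, Bool.not_true]
  rw [Nat.sub_sub_self hi.le] at e2
  omega

theorem indec_dual {w : List Bool} : Indec (dual w) ↔ Indec w :=
  ⟨fun h => by simpa [dual_dual] using h.to_dual, Indec.to_dual⟩

theorem num_dual (P : List Bool → Prop) (p q : ℕ) : num (fun w => P (dual w)) p q = num P q p := by
  unfold num
  have hinj : Function.Injective dual := fun a b h => by
    simpa [dual_dual] using congrArg dual h
  rw [← Set.ncard_image_of_injective (wordSet (fun w => P (dual w)) p q) hinj]
  congr 1
  ext w
  simp only [Set.mem_image, mem_wordSet]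
  constructor
  · rintro ⟨z, ⟨h, h1, h2⟩, rfl⟩
    exact ⟨h, by simpa [count_dual], by simpa [count_dual]⟩
  · rintro ⟨h, h1, h2⟩
    exact ⟨dual w, ⟨by rwa [dual_dual], by simpa [count_dual], by simpa [count_dual]⟩, dual_dual w⟩

/-- Every column of the polyomino whose lower boundary is `z`, the upper one being shifted by `d`,
overlaps with its successor. -/
def Column (d : ℕ) (z : List Bool) : Prop :=
  ∀ u u' v v' : List Bool, z = u ++ u' → z = v' ++ v → u.count false = v.count false →
    u.count true < d + v.count true

theorem replicate_append_eq {s : ℕ} {z u u' : List Bool}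
    (h : List.replicate s true ++ z = u ++ u') :
    (u.count false = 0 ∧ u.count true ≤ s) ∨ ∃ a, u = List.replicate s true ++ a ∧ z = a ++ u' := by
  rcases List.append_eq_append_iff.1 h with ⟨a, rfl, rfl⟩ | ⟨a, h1, rfl⟩
  · exact Or.inr ⟨a, rfl, rfl⟩
  · left
    have h2 := congrArg (List.count false) h1
    have h3 := congrArg (List.count true) h1
    simp [List.count_replicate] at h2 h3
    omega

theorem append_replicate_eq {t : ℕ} {z v v' : List Bool}
    (h : z ++ List.replicate t true = v' ++ v) :
    (v.count false = 0 ∧ v.count true ≤ t) ∨ ∃ a, v = a ++ List.replicate t true ∧ z = v' ++ a := by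
  rcases List.append_eq_append_iff.1 h with ⟨a, h1, h2⟩ | ⟨a, rfl, rfl⟩
  · left
    have h3 := congrArg (List.count false) h2
    have h4 := congrArg (List.count true) h2
    simp [List.count_replicate] at h3 h4
    omega
  · exact Or.inr ⟨a, rfl, rfl⟩

theorem column_layer {d s t : ℕ} {z : List Bool} :
    Column d (List.replicate s true ++ (false :: (z ++ (false :: List.replicate t true)))) ↔
      s < d ∧ Column (d + t - s) z := by
  constructor
  · intro h
    have hs : s < d := by
      simpa using h (List.replicate s true) _ [] _ rfl (List.append_nil _).symm
        (by simp [List.count_replicate])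
    refine ⟨hs, fun u u' v v' h1 h2 h3 => ?_⟩
    have := h (List.replicate s true ++ false :: u) (u' ++ (false :: List.replicate t true))
      (v ++ false :: List.replicate t true) (List.replicate s true ++ false :: v')
      (by simp [h1]) (by simp [h2]) (by simp [List.count_replicate, h3])
    simp at this
    omega
  · rintro ⟨hs, h⟩ u u' v v' h1 h2 h3
    rcases replicate_append_eq h1 with ⟨-, hu⟩ | ⟨_ | ⟨a, u1⟩, rfl, hu⟩
    · omega
    · simp; omega
    obtain ⟨rfl, hu'⟩ : false = a ∧ z ++ false :: List.replicate t true = u1 ++ u' := by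
      simpa using hu
    have h2' : (List.replicate s true ++ false :: (z ++ [false])) ++ List.replicate t true =
        v' ++ v := by simp [← h2]
    rcases append_replicate_eq h2' with ⟨hv, -⟩ | ⟨v1, rfl, hv⟩
    · simp at h3; omega
    rcases List.eq_nil_or_concat v1 with rfl | ⟨v2, b, rfl⟩
    · simp [List.count_replicate] at h3
    have hv' : List.replicate s true ++ false :: z ++ [false] = v' ++ v2 ++ [b] := by
      simpa using hv
    obtain ⟨hv2, hb⟩ := List.append_inj' hv' rfl
    obtain rfl : false = b := by simpa using hb
    have e2 := congrArg (List.count true) hu'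
    have e4 := congrArg (List.count true) hv2
    simp [List.count_replicate] at h3 e2 e4 ⊢
    rcases replicate_append_eq hv2 with ⟨-, hw⟩ | ⟨_ | ⟨a, v3⟩, rfl, hw⟩
    · omega
    · simp at e4
      omega
    obtain ⟨rfl, hz⟩ : false = a ∧ z = v3 ++ v2 := by
      simpa only [List.cons_append, List.cons.injEq] using hw
    have e5 := congrArg (List.count false) hz
    simp at e5
    rcases List.append_eq_append_iff.1 hu' with ⟨_ | ⟨a, a'⟩, rfl, ha⟩ | ⟨a, hz', -⟩
    · have := h z [] v2 v3 (by simp) hz (by simpa using h3)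
      simp at e4 ⊢
      omega
    · obtain ⟨rfl, -⟩ : false = a ∧ List.replicate t true = a' ++ u' := by simpa using ha
      simp at h3
      omega
    · have := h u1 a v2 v3 hz' hz h3
      simp at e4
      omega

theorem column_single {d s t : ℕ} :
    Column d (List.replicate s true ++ ([false] ++ List.replicate t true)) ↔ s < d := by
  constructor
  · intro h
    simpa using h (List.replicate s true) _ [] _ rfl (List.append_nil _).symm
        (by simp [List.count_replicate])
  · intro hs u u' v v' h1 h2 h3
    have e1 := congrArg (List.count true) h1
    have e2 := congrArg (List.count false) h2
    simp [List.count_replicate] at e1 e2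
    have h2' : (List.replicate s true ++ [false]) ++ List.replicate t true = v' ++ v := by
      simp [← h2]
    rcases replicate_append_eq h1 with ⟨-, hu⟩ | ⟨_ | ⟨a, u1⟩, rfl, hu⟩
    · omega
    · simp; omega
    rcases append_replicate_eq h2' with ⟨hv, -⟩ | ⟨v1, rfl, hv⟩
    · obtain ⟨rfl, -⟩ : false = a ∧ List.replicate t true = u1 ++ u' := by simpa using hu
      simp at h3; omega
    simp at e1 ⊢
    omega

theorem column_replicate {d g : ℕ} : Column d (List.replicate g true) ↔ g < d := by
  constructor
  · intro h
    simpa using h (List.replicate g true) [] [] _ (by simp) (List.append_nil _).symm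
        (by simp [List.count_replicate])
  · intro hs u u' v v' h1 h2 h3
    have e1 := congrArg (List.count true) h1
    simp at e1
    omega

theorem exists_suffix (z : List Bool) {k : ℕ} (hk : k ≤ z.count false) :
    ∃ v' v, z = v' ++ v ∧ v.count false = k ∧
      ∀ y x, z = y ++ x → k ≤ x.count false → v.count true ≤ x.count true := by
  induction z with
  | nil => exact ⟨[], [], rfl, by simpa [eq_comm] using hk, by simp⟩
  | cons a z ih =>
    by_cases h : k ≤ z.count false
    · obtain ⟨v', v, rfl, hv, hm⟩ := ih h
      refine ⟨a :: v', v, rfl, hv, ?_⟩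
      rintro (_ | ⟨b, y⟩) x hx hkx
      · obtain rfl : a :: (v' ++ v) = x := hx
        simp [List.count_cons]
        omega
      · obtain ⟨rfl, hx'⟩ : a = b ∧ v' ++ v = y ++ x := by simpa using hx
        exact hm y x hx' hkx
    · have hc : (a :: z).count false = k := by
        rw [List.count_cons] at hk ⊢
        split_ifs at hk ⊢ <;> omega
      refine ⟨[], a :: z, rfl, hc, ?_⟩
      rintro (_ | ⟨b, y⟩) x hx hkx
      · obtain rfl : a :: z = x := hx
        rfl
      · obtain ⟨rfl, rfl⟩ : a = b ∧ z = y ++ x := by simpa using hx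
        rw [List.count_append] at h
        omega

theorem indec_iff_split {w : List Bool} :
    Indec w ↔ 2 ≤ w.length ∧ ∀ u u' v' v, w = u ++ u' → w = v' ++ v → u.length = v.length →
      u ≠ [] → u' ≠ [] → u.count true < v.count true := by
  refine and_congr Iff.rfl ⟨fun h u u' v' v h1 h2 h3 h4 h5 => ?_, fun h i h0 hi => ?_⟩
  · have l1 := congrArg List.length h1
    have l2 := congrArg List.length h2
    rw [List.length_append] at l1 l2
    have c2 := congrArg (List.count true) h2
    rw [List.count_append] at c2
    have := List.length_pos_iff.2 h4
    have := List.length_pos_iff.2 h5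
    have := h u.length (by omega) (by omega)
    have t1 : w.take u.length = u := by rw [h1, List.take_left]
    have t2 : w.take (w.length - u.length) = v' := by
      rw [show w.length - u.length = v'.length by omega, h2, List.take_left]
    rw [t1, t2] at this
    omega
  · have h2 := (List.take_append_drop (w.length - i) w).symm
    have := h (w.take i) (w.drop i) _ _ (List.take_append_drop i w).symm h2
      (by simp; omega) (by rw [← List.length_pos_iff]; simp; omega)
      (by rw [← List.length_pos_iff]; simp; omega)
    have c2 := congrArg (List.count true) h2
    rw [List.count_append] at c2
    omega

theorem indec_single {t : ℕ} : Indec (false :: List.replicate t true) ↔ 1 ≤ t := by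
  rw [indec_iff_split]
  constructor
  · rintro ⟨h, -⟩
    simp at h
    omega
  · intro ht
    refine ⟨by simp; omega, ?_⟩
    rintro (_ | ⟨a, u⟩) u' (_ | ⟨b, v'⟩) v h1 h2 h3 h4 h5
    · simp at h4
    · simp at h4
    · have l1 := congrArg List.length h1
      have l2 := congrArg List.length h2
      have := List.length_pos_iff.2 h5
      simp only [List.length_append, List.nil_append] at l1 l2
      omega
    · obtain ⟨rfl, hu⟩ : false = a ∧ List.replicate t true = u ++ u' := by simpa using h1
      obtain ⟨rfl, hv⟩ : false = b ∧ List.replicate t true = v' ++ v := by simpa using h2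
      rw [← count_false_add_count_true, ← count_false_add_count_true] at h3
      have e3 := congrArg (List.count false) hv
      have e4 := congrArg (List.count false) hu
      simp [List.count_replicate, -List.count_false_add_count_true] at e3 e4 h3 ⊢
      omega

theorem indec_layer {t : ℕ} {z : List Bool} :
    Indec (false :: (z ++ (false :: List.replicate t true))) ↔ 1 ≤ t ∧ Column t z := by
  rw [indec_iff_split]
  constructor
  · rintro ⟨-, h⟩
    have ht : 1 ≤ t := by
      by_contra ht
      obtain rfl : t = 0 := by omega
      simpa using h [false] _ (false :: z) [false] rfl (by simp) rfl (by simp) (by simp)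
    refine ⟨ht, fun u u' v v' h1 h2 h3 => ?_⟩
    by_contra hc
    have f1 := count_false_add_count_true u
    have f2 := count_false_add_count_true v
    have l1 := congrArg List.length h1
    rw [List.length_append] at l1
    obtain ⟨u0, a, hu0, hl⟩ : ∃ u0 a, false :: u = u0 ++ a ∧ u0.length = v.length + 1 + t :=
      ⟨_, _, (List.take_append_drop (v.length + 1 + t) _).symm, by simp; omega⟩
    have := h u0 (a ++ (u' ++ (false :: List.replicate t true))) (false :: v')
      (v ++ (false :: List.replicate t true))
      (by rw [← List.append_assoc, ← hu0, h1]; simp) (by rw [h2]; simp) (by simp; omega)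
      (by rw [← List.length_pos_iff]; omega) (by simp)
    have f3 := count_false_add_count_true u0
    have f4 := congrArg (List.count false) hu0
    simp at this f4
    omega
  · rintro ⟨ht, h⟩
    refine ⟨by simp; omega, fun u u' v' v h1 h2 h3 h4 h5 => ?_⟩
    by_contra hc
    obtain _ | ⟨a, u⟩ := u
    · simp at h4
    obtain ⟨rfl, hu⟩ : false = a ∧ z ++ (false :: List.replicate t true) = u ++ u' := by
      simpa using h1
    have hv' : v' ≠ [] := by
      rintro rfl
      have l1 := congrArg List.length h1
      have := List.length_pos_iff.2 h5
      rw [h2, List.nil_append, List.length_append] at l1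
      omega
    rw [← count_false_add_count_true, ← count_false_add_count_true] at h3
    have h2' : false :: (z ++ [false]) ++ List.replicate t true = v' ++ v := by simp [← h2]
    rcases append_replicate_eq h2' with ⟨hv, -⟩ | ⟨v1, rfl, hv⟩
    · simp [-List.count_false_add_count_true] at h3 hc
      omega
    rcases List.eq_nil_or_concat v1 with rfl | ⟨v2, b, rfl⟩
    · simp [List.count_replicate] at hc h3
      omega
    have hvv : false :: z ++ [false] = v' ++ v2 ++ [b] := by simpa using hv
    obtain ⟨hv2, hb⟩ := List.append_inj' hvv rfl
    obtain rfl : false = b := by simpa using hb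
    obtain _ | ⟨c, v3⟩ := v'
    · exact hv' rfl
    obtain ⟨rfl, hz⟩ : false = c ∧ z = v3 ++ v2 := by simpa using hv2
    have e5 := congrArg (List.count false) hz
    simp [List.count_replicate] at e5 h3 hc
    rcases List.append_eq_append_iff.1 hu with ⟨_ | ⟨a, a'⟩, rfl, ha⟩ | ⟨a, hz', -⟩
    · obtain ⟨y, x, hx, hx', hm⟩ := exists_suffix z (k := z.count false) le_rfl
      have := h z [] x y (by simp) hx hx'.symm
      simp at hc h3
      have := hm v3 v2 hz (by omega)
      omega
    · obtain ⟨rfl, -⟩ : false = a ∧ List.replicate t true = a' ++ u' := by simpa using ha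
      simp at h3 hc
      omega
    · have := congrArg (List.count false) hz'
      rw [List.count_append] at this
      obtain ⟨y, x, hx, hx', hm⟩ := exists_suffix z (k := u.count false) (by omega)
      have := h u a x y hz' hx hx'.symm
      have := hm v3 v2 hz (by omega)
      omega

end SimpleAvInv

namespace SimpleAvInv

/-- The middle of a word: a single `false`, or two of them separated by `g` letters `true`. -/
def core : Option ℕ → List Bool
  | none => [false]
  | some g => false :: (List.replicate g true ++ [false])

/-- The word with middle `core o` surrounded by layers: all but the innermost are of the form
`true ^ s, false, ⬝, false, true ^ t`. -/
def build (o : Option ℕ) : ℕ × ℕ → List (ℕ × ℕ) → List Bool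
  | x, [] => List.replicate x.1 true ++ (core o ++ List.replicate x.2 true)
  | x, y :: l =>
    List.replicate x.1 true ++ (false :: (build o y l ++ (false :: List.replicate x.2 true)))

/-- The overlap condition for the columns of the polyomino of a word given by its layers. -/
def Fits (o : Option ℕ) : ℕ → List (ℕ × ℕ) → Prop
  | d, [] => ∀ g ∈ o, g < d
  | d, y :: l => y.1 < d ∧ Fits o (d + y.2 - y.1) l

theorem count_true_build (o : Option ℕ) (x : ℕ × ℕ) (l : List (ℕ × ℕ)) :
    (build o x l).count true = x.1 + x.2 + (l.map fun y => y.1 + y.2).sum + o.getD 0 := by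
  induction l generalizing x with
  | nil =>
    cases o
    · simp [build, core]
    · simp [build, core]; omega
  | cons y l ih => simp [build, ih]; omega

theorem count_false_build (o : Option ℕ) (x : ℕ × ℕ) (l : List (ℕ × ℕ)) :
    (build o x l).count false = 2 * l.length + (core o).count false := by
  induction l generalizing x with
  | nil => simp [build, List.count_replicate]
  | cons y l ih => simp [build, ih, List.count_replicate]; omega

theorem column_build {o : Option ℕ} {d : ℕ} {x : ℕ × ℕ} {l : List (ℕ × ℕ)} :
    Column d (build o x l) ↔ x.1 < d ∧ Fits o (d + x.2 - x.1) l := by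
  induction l generalizing x d with
  | nil =>
    cases o with
    | none =>
      rw [build, core, column_single]
      simp [Fits]
    | some g =>
      have := column_layer (d := d) (s := x.1) (t := x.2) (z := List.replicate g true)
      rw [column_replicate] at this
      simpa [build, core, Fits] using this
  | cons y l ih =>
    rw [build, column_layer, ih, Fits]

theorem indec_build {o : Option ℕ} {x : ℕ × ℕ} {l : List (ℕ × ℕ)} :
    Indec (build o x l) ↔ x.1 = 0 ∧ 1 ≤ x.2 ∧ Fits o x.2 l := by
  obtain ⟨s, t⟩ := x
  rcases Nat.eq_zero_or_pos s with rfl | hs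
  · rw [and_iff_right rfl]
    cases l with
    | nil =>
      cases o with
      | none => simpa [build, core, Fits] using indec_single
      | some g =>
        have := indec_layer (t := t) (z := List.replicate g true)
        rw [column_replicate] at this
        simpa [build, core, Fits] using this
    | cons y l =>
      have := indec_layer (t := t) (z := build o y l)
      rw [column_build] at this
      simpa [build, Fits] using this
  · constructor
    · intro h
      obtain ⟨z, hz, -⟩ := indec_iff_ends.1 h
      obtain ⟨m, rfl⟩ : ∃ m, s = m + 1 := ⟨s - 1, by omega⟩
      cases l <;> simp [build, List.replicate_succ] at hz
    · rintro ⟨h, -⟩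
      exact absurd h hs.ne'

theorem fits_stutter {o : Option ℕ} {d : ℕ} (hd : 0 < d) (l₁ l₂ : List (ℕ × ℕ)) :
    Fits o d (l₁ ++ (0, 0) :: l₂) ↔ Fits o d (l₁ ++ l₂) := by
  induction l₁ generalizing d with
  | nil => simp [Fits, hd]
  | cons y l ih =>
    simp only [List.cons_append, Fits]
    refine and_congr_right fun h => ih (by omega)

theorem fits_some_zero {d : ℕ} (hd : 0 < d) (l : List (ℕ × ℕ)) :
    Fits (some 0) d l ↔ Fits none d l := by
  induction l generalizing d with
  | nil => simp [Fits, hd]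
  | cons y l ih =>
    simp only [Fits]
    refine and_congr_right fun h => ih (by omega)

theorem occ_false_build_zero (o : Option ℕ) (x : ℕ × ℕ) (l : List (ℕ × ℕ)) (k : ℕ) :
    Occ false (build o x ((0, 0) :: l)) k ↔ Occ false (build o x l) k := by
  cases l with
  | nil => cases o <;> simp [build, core, occ_append, occ_cons, occ_replicate]
  | cons y l => simp [build, occ_append, occ_cons, occ_replicate]

theorem occ_false_build_cons_congr {o o' : Option ℕ} {x y y' : ℕ × ℕ} {l l' : List (ℕ × ℕ)}
    (hc : (build o y l).count true = (build o' y' l').count true)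
    (h : ∀ k, Occ false (build o y l) k ↔ Occ false (build o' y' l') k) (k : ℕ) :
    Occ false (build o x (y :: l)) k ↔ Occ false (build o' x (y' :: l')) k := by
  simp [build, occ_append, occ_cons, occ_replicate, h, hc]

theorem occ_false_build_stutter (o : Option ℕ) (x : ℕ × ℕ) (l₁ l₂ : List (ℕ × ℕ)) (k : ℕ) :
    Occ false (build o x (l₁ ++ (0, 0) :: l₂)) k ↔ Occ false (build o x (l₁ ++ l₂)) k := by
  induction l₁ generalizing x k with
  | nil => exact occ_false_build_zero o x l₂ k
  | cons y l ih =>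
    exact occ_false_build_cons_congr (by simp [count_true_build]) (fun k => ih y k) k

theorem occ_false_build_some_zero (x : ℕ × ℕ) (l : List (ℕ × ℕ)) (k : ℕ) :
    Occ false (build (some 0) x l) k ↔ Occ false (build none x l) k := by
  induction l generalizing x k with
  | nil => simp [build, core, occ_append, occ_cons, occ_replicate]
  | cons y l ih =>
    exact occ_false_build_cons_congr (by simp [count_true_build]) (fun k => ih y k) k

theorem reduced_false_congr {w w' : List Bool} (hc : w.count true = w'.count true)
    (h : ∀ k, Occ false w k ↔ Occ false w' k) : Reduced false w ↔ Reduced false w' := by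
  simp only [Reduced, h, Bool.not_false, hc]

/-- A letter `true` or a mirror image of one stands at each place before, between or after the
letters `false`. -/
def Filled (z : List Bool) : Prop :=
  ∀ k ≤ z.count false, Occ true z k ∨ Occ true z (z.count false - k)

theorem occ_true_layer {s t k : ℕ} {z : List Bool} :
    Occ true (List.replicate s true ++ (false :: (z ++ (false :: List.replicate t true)))) k ↔
      (0 < s ∧ k = 0) ∨ (∃ j, k = j + 1 ∧ Occ true z j) ∨ (0 < t ∧ k = z.count false + 2) := by
  simp only [occ_append, occ_cons, occ_replicate, List.count_replicate]
  constructor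
  · rintro (⟨-, h1, h2⟩ | ⟨j, rfl, ⟨h, -⟩ | ⟨i, rfl, h | ⟨_, rfl, ⟨h, -⟩ | ⟨_, rfl, -, h, rfl⟩⟩⟩⟩)
    · exact Or.inl ⟨h1, h2⟩
    · simp at h
    · exact Or.inr (Or.inl ⟨i, by simp [add_comm], h⟩)
    · simp at h
    · exact Or.inr (Or.inr ⟨h, by simp; omega⟩)
  · rintro (⟨h1, h2⟩ | ⟨j, rfl, h⟩ | ⟨h1, rfl⟩)
    · exact Or.inl ⟨trivial, h1, h2⟩
    · exact Or.inr ⟨j + 1, by simp, Or.inr ⟨j, by simp [add_comm], Or.inl h⟩⟩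
    · exact Or.inr ⟨z.count false + 2, by simp, Or.inr ⟨z.count false + 1, by simp; omega,
        Or.inr ⟨1, by simp, Or.inr ⟨0, by simp, trivial, h1, rfl⟩⟩⟩⟩

theorem count_false_layer {s t : ℕ} {z : List Bool} :
    (List.replicate s true ++ (false :: (z ++ (false :: List.replicate t true)))).count false =
      z.count false + 2 := by
  simp [List.count_replicate]

theorem filled_layer {s t : ℕ} {z : List Bool} :
    Filled (List.replicate s true ++ (false :: (z ++ (false :: List.replicate t true)))) ↔
      (s, t) ≠ (0, 0) ∧ Filled z := by
  unfold Filled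
  simp only [occ_true_layer, count_false_layer]
  have hz : ∀ j, Occ true z j → j ≤ z.count false := fun j h => h.le_count
  have hne : (s, t) ≠ (0, 0) ↔ 0 < s ∨ 0 < t := by
    rw [Ne, Prod.mk.injEq]
    omega
  rw [hne]
  constructor
  · intro h
    constructor
    · rcases h 0 (by omega) with (⟨h, -⟩ | ⟨j, h, -⟩ | ⟨h, -⟩) | (⟨h, -⟩ | ⟨j, h, h'⟩ | ⟨h, -⟩)
      · exact Or.inl h
      · omega
      · exact Or.inr h
      · exact Or.inl h
      · have := hz j h'
        omega
      · exact Or.inr h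
    · intro k hk
      rcases h (k + 1) (by omega) with
        (⟨-, h⟩ | ⟨j, h, h'⟩ | ⟨-, h⟩) | (⟨-, h⟩ | ⟨j, h, h'⟩ | ⟨-, h⟩)
      · omega
      · obtain rfl : k = j := by omega
        exact Or.inl h'
      · omega
      · omega
      · obtain rfl : z.count false - k = j := by omega
        exact Or.inr h'
      · omega
  · rintro ⟨h0, h⟩ k hk
    rcases Nat.eq_zero_or_pos k with rfl | hk0
    · rcases h0 with h0 | h0
      · exact Or.inl (Or.inl ⟨h0, rfl⟩)
      · exact Or.inr (Or.inr (Or.inr ⟨h0, rfl⟩))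
    rcases Nat.lt_or_ge (z.count false + 1) k with hk1 | hk1
    · obtain rfl : k = z.count false + 2 := by omega
      rcases h0 with h0 | h0
      · exact Or.inr (Or.inl ⟨h0, by omega⟩)
      · exact Or.inl (Or.inr (Or.inr ⟨h0, rfl⟩))
    · rcases h (k - 1) (by omega) with h | h
      · exact Or.inl (Or.inr (Or.inl ⟨k - 1, by omega, h⟩))
      · exact Or.inr (Or.inr (Or.inl ⟨_, by omega, h⟩))

theorem reduced_true_layer {t : ℕ} {z : List Bool} :
    Reduced true (false :: (z ++ (false :: List.replicate t true))) ↔ Filled z := by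
  have e := fun k => occ_true_layer (s := 0) (t := t) (k := k) (z := z)
  have c := count_false_layer (s := 0) (t := t) (z := z)
  have hz : ∀ j, Occ true z j → j ≤ z.count false := fun j h => h.le_count
  simp only [List.replicate_zero, List.nil_append, lt_irrefl, false_and, false_or] at e c
  unfold Reduced Filled
  simp only [Bool.not_true, e, c]
  constructor
  · intro h k hk
    rcases h (k + 1) (by omega) (by omega) with (⟨j, h, h'⟩ | ⟨-, h⟩) | (⟨j, h, h'⟩ | ⟨-, h⟩)
    · obtain rfl : k = j := by omega
      exact Or.inl h'
    · omega
    · obtain rfl : z.count false - k = j := by omega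
      exact Or.inr h'
    · omega
  · intro h k h0 hk
    rcases h (k - 1) (by omega) with h | h
    · exact Or.inl (Or.inl ⟨k - 1, by omega, h⟩)
    · exact Or.inr (Or.inl ⟨_, by omega, h⟩)

theorem filled_replicate {g : ℕ} : Filled (List.replicate g true) ↔ g ≠ 0 := by
  simp [Filled, List.count_replicate, occ_replicate, Nat.pos_iff_ne_zero]

theorem filled_single {s t : ℕ} :
    Filled (List.replicate s true ++ ([false] ++ List.replicate t true)) ↔ (s, t) ≠ (0, 0) := by
  simp only [Filled, occ_append, occ_singleton, occ_replicate, List.count_append,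
    List.count_replicate]
  rw [Ne, Prod.mk.injEq]
  constructor
  · intro h
    have := h 0 (by simp)
    simp at this
    omega
  · intro h k hk
    simp at hk
    rcases Nat.le_one_iff_eq_zero_or_eq_one.1 hk with rfl | rfl <;> simp <;> omega

theorem filled_build {o : Option ℕ} {x : ℕ × ℕ} {l : List (ℕ × ℕ)} :
    Filled (build o x l) ↔ o ≠ some 0 ∧ x ≠ (0, 0) ∧ (0, 0) ∉ l := by
  induction l generalizing x with
  | nil =>
    cases o with
    | none =>
      rw [build, core, filled_single]
      simp
    | some g =>
      have := filled_layer (s := x.1) (t := x.2) (z := List.replicate g true)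
      rw [filled_replicate] at this
      simpa [build, core, and_comm] using this
  | cons y l ih =>
    rw [build, filled_layer, ih]
    simp [eq_comm]
    tauto

theorem reduced_true_build {o : Option ℕ} {t : ℕ} {l : List (ℕ × ℕ)} :
    Reduced true (build o (0, t) l) ↔ o ≠ some 0 ∧ (0, 0) ∉ l := by
  cases l with
  | nil =>
    cases o with
    | none => simp [build, core, Reduced, List.count_replicate]; omega
    | some g =>
      have := reduced_true_layer (t := t) (z := List.replicate g true)
      rw [filled_replicate] at this
      simpa [build, core] using this
  | cons y l =>
    have := reduced_true_layer (t := t) (z := build o y l)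
    rw [filled_build] at this
    simpa [build, eq_comm] using this

theorem eq_replicate_of_count_false {z : List Bool} (h : z.count false = 0) :
    z = List.replicate (z.count true) true := by
  rw [List.eq_replicate_iff]
  refine ⟨by rw [← count_false_add_count_true, h, zero_add], fun b hb => ?_⟩
  cases b
  · exact absurd hb (List.count_eq_zero.1 h)
  · rfl

theorem exists_left {w : List Bool} (h : 1 ≤ w.count false) :
    ∃ s z, w = List.replicate s true ++ false :: z := by
  induction w with
  | nil => simp at h
  | cons a w ih =>
    cases a with
    | false => exact ⟨0, w, rfl⟩
    | true =>
      obtain ⟨s, z, rfl⟩ := ih (by simpa using h)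
      exact ⟨s + 1, z, by simp [List.replicate_succ]⟩

theorem exists_right {w : List Bool} (h : 1 ≤ w.count false) :
    ∃ t z, w = z ++ false :: List.replicate t true := by
  obtain ⟨t, z, hz⟩ := exists_left (w := w.reverse) (by simpa using h)
  refine ⟨t, z.reverse, ?_⟩
  rw [← List.reverse_reverse w, hz]
  simp

theorem left_injective {s s' : ℕ} {z z' : List Bool}
    (h : List.replicate s true ++ false :: z = List.replicate s' true ++ false :: z') :
    s = s' ∧ z = z' := by
  induction s generalizing s' with
  | zero =>
    cases s' with
    | zero => simpa using h
    | succ s' => simp [List.replicate_succ] at h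
  | succ s ih =>
    cases s' with
    | zero => simp [List.replicate_succ] at h
    | succ s' =>
      obtain ⟨rfl, rfl⟩ := ih (s' := s') (by simpa [List.replicate_succ] using h)
      exact ⟨rfl, rfl⟩

theorem right_injective {t t' : ℕ} {z z' : List Bool}
    (h : z ++ false :: List.replicate t true = z' ++ false :: List.replicate t' true) :
    t = t' ∧ z = z' := by
  have := congrArg List.reverse h
  obtain ⟨rfl, h'⟩ := left_injective (z := z.reverse) (z' := z'.reverse) (by simpa using this)
  exact ⟨rfl, by simpa using h'⟩

theorem exists_build {w : List Bool} {c : ℕ} : 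
    (w.count false = 2 * c + 1 → ∃ x l, w = build none x l ∧ l.length = c) ∧
    (w.count false = 2 * c + 2 → ∃ g x l, w = build (some g) x l ∧ l.length = c) := by
  induction c generalizing w with
  | zero =>
    constructor
    · intro h
      obtain ⟨s, z, rfl⟩ := exists_left (w := w) (by omega)
      have hz := eq_replicate_of_count_false (z := z)
        (by simp [List.count_replicate] at h; omega)
      exact ⟨(s, z.count true), [], by rw [build, core, ← hz]; simp, rfl⟩
    · intro h
      obtain ⟨s, z, rfl⟩ := exists_left (w := w) (by omega)
      obtain ⟨t, z, rfl⟩ := exists_right (w := z) (by simp [List.count_replicate] at h; omega)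
      have hz := eq_replicate_of_count_false (z := z)
        (by simp [List.count_replicate] at h; omega)
      exact ⟨z.count true, (s, t), [], by rw [build, core, ← hz]; simp, rfl⟩
  | succ c ih =>
    constructor
    · intro h
      obtain ⟨s, z, rfl⟩ := exists_left (w := w) (by omega)
      obtain ⟨t, z, rfl⟩ := exists_right (w := z) (by simp [List.count_replicate] at h; omega)
      obtain ⟨x, l, rfl, hl⟩ := (ih (w := z)).1 (by simp [List.count_replicate] at h; omega)
      exact ⟨(s, t), x :: l, by simp [build], by simp [hl]⟩
    · intro h
      obtain ⟨s, z, rfl⟩ := exists_left (w := w) (by omega)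
      obtain ⟨t, z, rfl⟩ := exists_right (w := z) (by simp [List.count_replicate] at h; omega)
      obtain ⟨g, x, l, rfl, hl⟩ := (ih (w := z)).2 (by simp [List.count_replicate] at h; omega)
      exact ⟨g, (s, t), x :: l, by simp [build], by simp [hl]⟩

theorem build_injective {o o' : Option ℕ} {x x' : ℕ × ℕ} {l l' : List (ℕ × ℕ)}
    (h : build o x l = build o' x' l') (hl : l.length = l'.length) : o = o' ∧ x = x' ∧ l = l' := by
  induction l generalizing x x' l' with
  | nil =>
    obtain rfl : l' = [] := List.eq_nil_of_length_eq_zero hl.symm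
    have hc := congrArg (List.count false) h
    rw [count_false_build, count_false_build] at hc
    obtain ⟨s, t⟩ := x
    obtain ⟨s', t'⟩ := x'
    cases o with
    | none =>
      cases o' with
      | none => 
        obtain ⟨rfl, h1⟩ := left_injective (by simpa [build, core] using h)
        simpa using h1
      | some g => simp [core] at hc
    | some g =>
      cases o' with
      | none => simp [core] at hc
      | some g' =>
        obtain ⟨rfl, h1⟩ := left_injective (by simpa [build, core] using h)
        obtain ⟨rfl, h2⟩ := right_injective h1
        simpa using h2
  | cons y l ih =>
    obtain _ | ⟨y', l'⟩ := l'
    · simp at hl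
    obtain ⟨s, t⟩ := x
    obtain ⟨s', t'⟩ := x'
    obtain ⟨hs, h1⟩ := left_injective h
    obtain ⟨ht, h2⟩ := right_injective h1
    obtain ⟨rfl, rfl, rfl⟩ := ih h2 (by simpa using hl)
    obtain rfl : s = s' := hs
    obtain rfl : t = t' := ht
    exact ⟨rfl, rfl, rfl⟩

end SimpleAvInv

namespace SimpleAvInv

/-- If membership in a class of lists is not affected by deleting letters `z`, then all lists of the
class are obtained from those without `z` by inserting letters `z`. -/
theorem ncard_stutter {α β : Type} (z : α) (X : β → List α → Prop)
    (hX : ∀ b l₁ l₂, X b (l₁ ++ z :: l₂) ↔ X b (l₁ ++ l₂))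
    (hf : ∀ c, {p : β × List α | p.2.length = c ∧ X p.1 p.2}.Finite) (c : ℕ) :
    {p : β × List α | p.2.length = c ∧ X p.1 p.2}.ncard = ∑ i ∈ Finset.range (c + 1),
      c.choose i * {p : β × List α | p.2.length = i ∧ X p.1 p.2 ∧ z ∉ p.2}.ncard := by
  induction c generalizing β with
  | zero =>
    rw [Finset.sum_range_one, Nat.choose_self, one_mul]
    congr 1
    ext ⟨b, l⟩
    simp only [Set.mem_ofPred_eq]
    refine and_congr_right fun h => ?_
    obtain rfl := List.eq_nil_of_length_eq_zero h
    simp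
  | succ c ih =>
    let f : β × List α → β × List α := fun p => (p.1, z :: p.2)
    let g : (β × α) × List α → β × List α := fun p => (p.1.1, p.1.2 :: p.2)
    have hfi : f.Injective := by
      rintro ⟨b, l⟩ ⟨b', l'⟩ h
      simpa [f] using h
    have hgi : g.Injective := by
      rintro ⟨⟨b, a⟩, l⟩ ⟨⟨b', a'⟩, l'⟩ h
      simpa [g, and_assoc] using h
    let Y : β × α → List α → Prop := fun b l => b.2 ≠ z ∧ X b.1 (b.2 :: l)
    have hY : ∀ b l₁ l₂, Y b (l₁ ++ z :: l₂) ↔ Y b (l₁ ++ l₂) := fun b l₁ l₂ =>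
      and_congr_right fun _ => hX b.1 (b.2 :: l₁) l₂
    have hdec : {p : β × List α | p.2.length = c + 1 ∧ X p.1 p.2} =
        f '' {p | p.2.length = c ∧ X p.1 p.2} ∪ g '' {p | p.2.length = c ∧ Y p.1 p.2} := by
      ext ⟨b, l⟩
      constructor
      · rintro ⟨h1, h2⟩
        obtain _ | ⟨a, l⟩ := l
        · simp at h1
        by_cases ha : a = z
        · subst ha
          exact Or.inl ⟨(b, l), ⟨by simpa using h1, (hX b [] l).1 h2⟩, rfl⟩
        · exact Or.inr ⟨((b, a), l), ⟨by simpa using h1, ha, h2⟩, rfl⟩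
      · rintro (⟨⟨b, l⟩, ⟨h1, h2⟩, h⟩ | ⟨⟨⟨b, a⟩, l⟩, ⟨h1, h2, h3⟩, h⟩)
        · rw [← h]
          exact ⟨by simpa [f] using h1, (hX b [] l).2 h2⟩
        · rw [← h]
          exact ⟨by simpa [g] using h1, h3⟩
    have hfin := hf (c + 1)
    have hYf : ∀ c, {p : (β × α) × List α | p.2.length = c ∧ Y p.1 p.2}.Finite := by
      intro c
      refine Set.Finite.of_finite_image ((hf (c + 1)).subset ?_) hgi.injOn
      rintro _ ⟨⟨⟨b, a⟩, l⟩, ⟨h1, h2, h3⟩, rfl⟩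
      exact ⟨by simpa [g] using h1, h3⟩
    have hdisj : Disjoint (f '' {p | p.2.length = c ∧ X p.1 p.2})
        (g '' {p | p.2.length = c ∧ Y p.1 p.2}) := by
      rw [Set.disjoint_left]
      rintro _ ⟨⟨b, l⟩, -, rfl⟩ ⟨⟨⟨b', a⟩, l'⟩, ⟨-, h, -⟩, h'⟩
      have := congrArg Prod.snd h'
      simp only [f, g, List.cons.injEq] at this
      exact h this.1
    have hYs : ∀ i, {p : (β × α) × List α | p.2.length = i ∧ Y p.1 p.2 ∧ z ∉ p.2}.ncard =
        {p : β × List α | p.2.length = i + 1 ∧ X p.1 p.2 ∧ z ∉ p.2}.ncard := by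
      intro i
      rw [← Set.ncard_image_of_injective _ hgi]
      congr 1
      ext ⟨b, l⟩
      constructor
      · rintro ⟨⟨⟨b, a⟩, l⟩, ⟨h1, ⟨h2, h3⟩, h4⟩, h⟩
        rw [← h]
        refine ⟨by simpa [g] using h1, h3, ?_⟩
        simp [g, h4, Ne.symm h2]
      · rintro ⟨h1, h2, h3⟩
        obtain _ | ⟨a, l⟩ := l
        · simp at h1
        simp only [List.mem_cons, not_or] at h3
        exact ⟨((b, a), l), ⟨by simpa using h1, ⟨Ne.symm h3.1, h2⟩, h3.2⟩, rfl⟩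
    rw [hdec, Set.ncard_union_eq hdisj ((hf c).image f) ((hYf c).image g),
      Set.ncard_image_of_injective _ hfi, Set.ncard_image_of_injective _ hgi, ih X hX hf,
      ih Y hY hYf]
    simp only [hYs]
    rw [Finset.sum_range_succ' _ (c + 1)]
    simp only [Nat.choose_succ_succ, add_mul, Finset.sum_add_distrib]
    rw [Finset.sum_range_succ' _ c, Finset.sum_range_succ (fun x => c.choose (x + 1) * _) c]
    simp [Nat.choose_succ_self]
    ring

/-- A property of words that only depends on the polyomino up to repetition of columns. -/
structure ColumnInvariant (Q : List Bool → Prop) : Prop where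
  stutter : ∀ o x l₁ l₂, Q (build o x (l₁ ++ (0, 0) :: l₂)) ↔ Q (build o x (l₁ ++ l₂))
  center : ∀ x l, Q (build (some 0) x l) ↔ Q (build none x l)

theorem columnInvariant_true : ColumnInvariant fun _ => True := ⟨by simp, by simp⟩

theorem columnInvariant_reduced : ColumnInvariant (Reduced false) where
  stutter o x l₁ l₂ := reduced_false_congr (by simp [count_true_build])
    (occ_false_build_stutter o x l₁ l₂)
  center x l := reduced_false_congr (by simp [count_true_build]) (occ_false_build_some_zero x l)

theorem columnInvariant_indec : ColumnInvariant Indec where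
  stutter o x l₁ l₂ := by
    rw [indec_build, indec_build]
    exact and_congr_right fun _ => and_congr_right fun h => fits_stutter h l₁ l₂
  center x l := by
    rw [indec_build, indec_build]
    exact and_congr_right fun _ => and_congr_right fun h => fits_some_zero h l

theorem reduced_true_build_of_indec {o : Option ℕ} {x : ℕ × ℕ} {l : List (ℕ × ℕ)}
    (h : Indec (build o x l)) : Reduced true (build o x l) ↔ o ≠ some 0 ∧ (0, 0) ∉ l := by
  obtain ⟨s, t⟩ := x
  obtain rfl : s = 0 := (indec_build.1 h).1
  exact reduced_true_build

theorem num_odd_eq (P : List Bool → Prop) (c q : ℕ) : num P (2 * c + 1) q =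
    {p : (ℕ × ℕ) × List (ℕ × ℕ) | p.2.length = c ∧
      (P (build none p.1 p.2) ∧ (build none p.1 p.2).count true = q)}.ncard := by
  unfold num
  rw [← Set.InjOn.ncard_image (f := fun p : (ℕ × ℕ) × List (ℕ × ℕ) => build none p.1 p.2)]
  · congr 1
    ext w
    rw [mem_wordSet]
    constructor
    · rintro ⟨h1, h2, h3⟩
      obtain ⟨x, l, rfl, hl⟩ := exists_build.1 h2
      exact ⟨(x, l), ⟨hl, h1, h3⟩, rfl⟩
    · rintro ⟨⟨x, l⟩, ⟨h1, h2, h3⟩, rfl⟩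
      refine ⟨h2, ?_, h3⟩
      simp only [count_false_build, core] at h1 ⊢
      simp [h1]
  · rintro ⟨x, l⟩ ⟨h, -⟩ ⟨x', l'⟩ ⟨h', -⟩ hb
    obtain ⟨-, h1, h2⟩ := build_injective hb (h.trans h'.symm)
    exact Prod.ext h1 h2

theorem num_even_eq (P : List Bool → Prop) (c q : ℕ) : num P (2 * c + 2) q =
    {p : (ℕ × ℕ × ℕ) × List (ℕ × ℕ) | p.2.length = c ∧ (P (build (some p.1.1) p.1.2 p.2) ∧
      (build (some p.1.1) p.1.2 p.2).count true = q)}.ncard := by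
  unfold num
  rw [← Set.InjOn.ncard_image
    (f := fun p : (ℕ × ℕ × ℕ) × List (ℕ × ℕ) => build (some p.1.1) p.1.2 p.2)]
  · congr 1
    ext w
    rw [mem_wordSet]
    constructor
    · rintro ⟨h1, h2, h3⟩
      obtain ⟨g, x, l, rfl, hl⟩ := exists_build.2 h2
      exact ⟨((g, x), l), ⟨hl, h1, h3⟩, rfl⟩
    · rintro ⟨⟨⟨g, x⟩, l⟩, ⟨h1, h2, h3⟩, rfl⟩
      refine ⟨h2, ?_, h3⟩
      simp only [count_false_build, core] at h1 ⊢
      simp [h1, List.count_replicate]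
  · rintro ⟨⟨g, x⟩, l⟩ ⟨h, -⟩ ⟨⟨g', x'⟩, l'⟩ ⟨h', -⟩ hb
    obtain ⟨h0, h1, h2⟩ := build_injective hb (h.trans h'.symm)
    simp only [Option.some.injEq] at h0
    exact Prod.ext (Prod.ext h0 h1) h2

theorem num_odd {Q : List Bool → Prop} (hQ : ColumnInvariant Q) (c q : ℕ) :
    num (fun w => Indec w ∧ Q w) (2 * c + 1) q = ∑ i ∈ Finset.range (c + 1),
      c.choose i * num (fun w => Indec w ∧ Q w ∧ Reduced true w) (2 * i + 1) q := by
  rw [num_odd_eq, ncard_stutter (0, 0) (fun x l => (Indec (build none x l) ∧ Q (build none x l)) ∧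
    (build none x l).count true = q)]
  · refine Finset.sum_congr rfl fun i _ => ?_
    rw [num_odd_eq]
    congr 2
    ext ⟨x, l⟩
    refine and_congr_right fun _ => ?_
    have : Indec (build none x l) → (Reduced true (build none x l) ↔ (0, 0) ∉ l) := fun h => by
      simp [reduced_true_build_of_indec h]
    tauto
  · intro b l₁ l₂
    rw [columnInvariant_indec.stutter, hQ.stutter]
    simp [count_true_build]
  · intro c
    refine Set.Finite.of_finite_image (f := fun p => build none p.1 p.2)
      ((wordSet_finite (fun _ => True) (2 * c + 1) q).subset ?_) ?_
    · rintro _ ⟨⟨x, l⟩, ⟨h1, h2, h3⟩, rfl⟩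
      refine ⟨trivial, ?_, h3⟩
      simp only [count_false_build, core] at h1 ⊢
      simp [h1]
    · rintro ⟨x, l⟩ ⟨h, -⟩ ⟨x', l'⟩ ⟨h', -⟩ hb
      obtain ⟨-, h1, h2⟩ := build_injective hb (h.trans h'.symm)
      exact Prod.ext h1 h2

theorem num_even {Q : List Bool → Prop} (hQ : ColumnInvariant Q) (c q : ℕ) :
    num (fun w => Indec w ∧ Q w) (2 * c + 2) q = num (fun w => Indec w ∧ Q w) (2 * c + 1) q +
      ∑ i ∈ Finset.range (c + 1),
        c.choose i * num (fun w => Indec w ∧ Q w ∧ Reduced true w) (2 * i + 2) q := by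
  have hfin : ∀ c, {p : (ℕ × ℕ × ℕ) × List (ℕ × ℕ) | p.2.length = c ∧
      (Indec (build (some p.1.1) p.1.2 p.2) ∧ Q (build (some p.1.1) p.1.2 p.2)) ∧
      (build (some p.1.1) p.1.2 p.2).count true = q}.Finite := by
    intro c
    refine Set.Finite.of_finite_image (f := fun p => build (some p.1.1) p.1.2 p.2)
      ((wordSet_finite (fun _ => True) (2 * c + 2) q).subset ?_) ?_
    · rintro _ ⟨⟨⟨g, x⟩, l⟩, ⟨h1, h2, h3⟩, rfl⟩
      refine ⟨trivial, ?_, h3⟩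
      simp only [count_false_build, core] at h1 ⊢
      simp [h1, List.count_replicate]
    · rintro ⟨⟨g, x⟩, l⟩ ⟨h, -⟩ ⟨⟨g', x'⟩, l'⟩ ⟨h', -⟩ hb
      obtain ⟨h0, h1, h2⟩ := build_injective hb (h.trans h'.symm)
      simp only [Option.some.injEq] at h0
      exact Prod.ext (Prod.ext h0 h1) h2
  let f : (ℕ × ℕ) × List (ℕ × ℕ) → (ℕ × ℕ × ℕ) × List (ℕ × ℕ) := fun p => ((0, p.1), p.2)
  have hf : f.Injective := by
    rintro ⟨x, l⟩ ⟨x', l'⟩ h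
    simpa [f] using h
  have h1 : ∑ i ∈ Finset.range (c + 1),
      c.choose i * num (fun w => Indec w ∧ Q w ∧ Reduced true w) (2 * i + 2) q =
      {p : (ℕ × ℕ × ℕ) × List (ℕ × ℕ) | p.2.length = c ∧ p.1.1 ≠ 0 ∧
      (Indec (build (some p.1.1) p.1.2 p.2) ∧ Q (build (some p.1.1) p.1.2 p.2)) ∧
      (build (some p.1.1) p.1.2 p.2).count true = q}.ncard := by
    rw [ncard_stutter (0, 0) (fun (x : ℕ × ℕ × ℕ) l => x.1 ≠ 0 ∧ (Indec (build (some x.1) x.2 l) ∧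
      Q (build (some x.1) x.2 l)) ∧ (build (some x.1) x.2 l).count true = q)]
    · refine Finset.sum_congr rfl fun i _ => ?_
      rw [num_even_eq]
      congr 2
      ext ⟨⟨g, x⟩, l⟩
      refine and_congr_right fun _ => ?_
      have : Indec (build (some g) x l) → (Reduced true (build (some g) x l) ↔
          g ≠ 0 ∧ (0, 0) ∉ l) := fun h => by simp [reduced_true_build_of_indec h]
      tauto
    · intro b l₁ l₂
      rw [columnInvariant_indec.stutter, hQ.stutter]
      simp [count_true_build]
    · intro c
      refine (hfin c).subset ?_
      rintro p ⟨h1, -, h2⟩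
      exact ⟨h1, h2⟩
  have hdisj : Disjoint (f '' {p | p.2.length = c ∧
    (Indec (build none p.1 p.2) ∧ Q (build none p.1 p.2)) ∧
      (build none p.1 p.2).count true = q})
      {p : (ℕ × ℕ × ℕ) × List (ℕ × ℕ) | p.2.length = c ∧ p.1.1 ≠ 0 ∧
      (Indec (build (some p.1.1) p.1.2 p.2) ∧ Q (build (some p.1.1) p.1.2 p.2)) ∧
      (build (some p.1.1) p.1.2 p.2).count true = q} := by
    rw [Set.disjoint_left]
    rintro _ ⟨⟨x, l⟩, -, rfl⟩ ⟨-, h, -⟩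
    exact h rfl
  have hfin1 : (f '' {p | p.2.length = c ∧ (Indec (build none p.1 p.2) ∧ Q (build none p.1 p.2)) ∧
      (build none p.1 p.2).count true = q}).Finite := by
    refine (hfin c).subset ?_
    rintro _ ⟨⟨x, l⟩, ⟨h1, h2⟩, rfl⟩
    have hc : (build (some 0) x l).count true = (build none x l).count true := by
      simp [count_true_build]
    refine ⟨h1, ?_⟩
    simp only [f]
    simpa only [columnInvariant_indec.center, hQ.center, hc] using h2
  have hfin2 : {p : (ℕ × ℕ × ℕ) × List (ℕ × ℕ) | p.2.length = c ∧ p.1.1 ≠ 0 ∧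
      (Indec (build (some p.1.1) p.1.2 p.2) ∧ Q (build (some p.1.1) p.1.2 p.2)) ∧
      (build (some p.1.1) p.1.2 p.2).count true = q}.Finite := by
    refine (hfin c).subset ?_
    rintro p ⟨h1, -, h2⟩
    exact ⟨h1, h2⟩
  rw [h1, num_odd_eq, num_even_eq, ← Set.ncard_image_of_injective _ hf,
    ← Set.ncard_union_eq hdisj hfin1 hfin2]
  · congr 1
    ext ⟨⟨g, x⟩, l⟩
    have hc : (build (some 0) x l).count true = (build none x l).count true := by
      simp [count_true_build]
    constructor
    · rintro ⟨h1, h2⟩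
      rcases Nat.eq_zero_or_pos g with rfl | hg
      · refine Or.inl ⟨(x, l), ⟨h1, ?_⟩, rfl⟩
        simpa only [columnInvariant_indec.center, hQ.center, hc] using h2
      · exact Or.inr ⟨h1, hg.ne', h2⟩
    · rintro (⟨⟨x, l⟩, ⟨h1, h2⟩, h⟩ | ⟨h1, -, h2⟩)
      · have hc : (build (some 0) x l).count true = (build none x l).count true := by
          simp [count_true_build]
        rw [← h]
        refine ⟨h1, ?_⟩
        simp only [f]
        simpa only [columnInvariant_indec.center, hQ.center, hc] using h2
      · exact ⟨h1, h2⟩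

end SimpleAvInv

namespace SimpleAvInv

/-- Words of simple `123`-avoiding involutions (and of the permutation `12`). -/
def SimpleWord (w : List Bool) : Prop := Indec w ∧ Reduced false w ∧ Reduced true w

/-- The odd part of a sequence or the difference of its even and odd parts. -/
def parityPart (e : Bool) (f : ℕ → ℚ) (c : ℕ) : ℚ :=
  if e then f (2 * c + 2) - f (2 * c + 1) else f (2 * c + 1)

theorem parityPart_num {Q : List Bool → Prop} (hQ : ColumnInvariant Q) (e : Bool) (c q : ℕ) :
    parityPart e (fun p => (num (fun w => Indec w ∧ Q w) p q : ℚ)) c =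
      ∑ i ∈ Finset.range (c + 1), (c.choose i : ℚ) *
        num (fun w => Indec w ∧ Q w ∧ Reduced true w) (2 * i + 1 + e.toNat) q := by
  cases e with
  | false => simp [parityPart, num_odd hQ]
  | true => simp [parityPart, num_even hQ]

theorem parityPart_sum (e : Bool) (s : Finset ℕ) (a : ℕ → ℚ) (f : ℕ → ℕ → ℚ) (c : ℕ) :
    parityPart e (fun p => ∑ j ∈ s, a j * f p j) c =
      ∑ j ∈ s, a j * parityPart e (fun p => f p j) c := by
  cases e with
  | false => simp [parityPart]
  | true => simp [parityPart, mul_sub]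

theorem num_indec_eq (p q : ℕ) : num Indec p q = num (fun w => Indec w ∧ True) q p := by
  rw [← num_dual]
  exact num_congr fun w _ _ => by rw [indec_dual, and_true]

theorem num_reduced_true_eq (p q : ℕ) :
    num (fun w => Indec w ∧ True ∧ Reduced true w) p q =
      num (fun w => Indec w ∧ Reduced false w) q p := by
  rw [← num_dual]
  exact num_congr fun w _ _ => by rw [indec_dual, reduced_dual, true_and, Bool.not_true]

theorem parityPart_parityPart_num (e e' : Bool) (c d : ℕ) :
    parityPart e (fun p => parityPart e' (fun q => (num Indec p q : ℚ)) d) c =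
      ∑ i ∈ Finset.range (c + 1), ∑ j ∈ Finset.range (d + 1), (c.choose i : ℚ) * d.choose j *
        num SimpleWord (2 * i + 1 + e.toNat) (2 * j + 1 + e'.toNat) := by
  have h : ∀ p, parityPart e' (fun q => (num Indec p q : ℚ)) d =
      ∑ j ∈ Finset.range (d + 1), (d.choose j : ℚ) *
        num (fun w => Indec w ∧ Reduced false w) p (2 * j + 1 + e'.toNat) := by
    intro p
    simp only [num_indec_eq]
    rw [parityPart_num columnInvariant_true]
    simp only [num_reduced_true_eq]
  simp only [h]
  rw [parityPart_sum, Finset.sum_comm]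
  refine Finset.sum_congr rfl fun j _ => ?_
  rw [parityPart_num columnInvariant_reduced, Finset.mul_sum]
  refine Finset.sum_congr rfl fun i _ => ?_
  rw [show SimpleWord = fun w => Indec w ∧ Reduced false w ∧ Reduced true w from rfl]
  ring

end SimpleAvInv

namespace SimpleAvInv

open MvPowerSeries

/-- The power series with given coefficients. -/
def mk2 (f : ℕ → ℕ → ℚ) : MvPowerSeries (Fin 2) ℚ := fun m => f (m 0) (m 1)

theorem coeff_mk2 (f : ℕ → ℕ → ℚ) (m : Fin 2 →₀ ℕ) : coeff m (mk2 f) = f (m 0) (m 1) := rfl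

theorem mk2_add (f g : ℕ → ℕ → ℚ) : mk2 f + mk2 g = mk2 fun a b => f a b + g a b := rfl

theorem mk2_sub (f g : ℕ → ℕ → ℚ) : mk2 f - mk2 g = mk2 fun a b => f a b - g a b := by
  ext m; simp [coeff_mk2]

theorem X_zero_mul_mk2 (f : ℕ → ℕ → ℚ) :
    X 0 * mk2 f = mk2 fun a b => if 1 ≤ a then f (a - 1) b else 0 := by
  ext m
  rw [X, coeff_monomial_mul, coeff_mk2]
  simp [Finsupp.single_le_iff, coeff_mk2]

theorem X_one_mul_mk2 (f : ℕ → ℕ → ℚ) :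
    X 1 * mk2 f = mk2 fun a b => if 1 ≤ b then f a (b - 1) else 0 := by
  ext m
  rw [X, coeff_monomial_mul, coeff_mk2]
  simp [Finsupp.single_le_iff, coeff_mk2]

theorem one_eq_mk2 : (1 : MvPowerSeries (Fin 2) ℚ) =
    mk2 fun a b => if a = 0 ∧ b = 0 then 1 else 0 := by
  ext m
  rw [coeff_one, coeff_mk2]
  congr 1
  simp [Finsupp.ext_iff, Fin.forall_fin_two]

theorem mk2_congr {f g : ℕ → ℕ → ℚ} (h : ∀ a b, f a b = g a b) : mk2 f = mk2 g := by
  rw [show f = g from funext fun a => funext (h a)]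

theorem eq_mk2 (F : MvPowerSeries (Fin 2) ℚ) :
    F = mk2 fun a b => coeff (Finsupp.single 0 a + Finsupp.single 1 b) F := by
  ext m
  rw [coeff_mk2]
  refine congrArg (coeff · F) (Finsupp.ext fun i => ?_)
  fin_cases i <;> simp

/-- The numbers of words of positive height, by parity of the numbers of letters. -/
noncomputable def heightGF (i j d : ℕ) : MvPowerSeries (Fin 2) ℚ :=
  mk2 fun a b => num (Above d) (2 * a + i) (2 * b + j)

theorem heightGF_zero (i j : ℕ) : heightGF i j 0 = 0 := by
  have : ∀ p q, num (Above 0) p q = 0 := fun p q => by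
    rw [num, Set.ncard_eq_zero (wordSet_finite _ _ _)]
    ext w
    simp [mem_wordSet, not_above_zero]
  ext m
  simp [heightGF, coeff_mk2, this]

local notation "U" => (X 0 : MvPowerSeries (Fin 2) ℚ)
local notation "V" => (X 1 : MvPowerSeries (Fin 2) ℚ)

theorem num_above_rec_rat (d p q : ℕ) :
    (num (Above (d + 1)) p q : ℚ) = (if p + q ≤ 1 then 1 else 0) +
      ((if 2 ≤ p then (num (Above (d + 1)) (p - 2) q : ℚ) else 0) +
      (if 1 ≤ p ∧ 1 ≤ q then (num (Above (d + 2)) (p - 1) (q - 1) : ℚ) else 0) +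
      ((if 1 ≤ p ∧ 1 ≤ q then (num (Above d) (p - 1) (q - 1) : ℚ) else 0) +
      (if 2 ≤ q then (num (Above (d + 1)) p (q - 2) : ℚ) else 0))) := by
  exact_mod_cast num_above_rec d p q

theorem heightGF_even_even (d : ℕ) : heightGF 0 0 (d + 1) = 1 + (U + V) * heightGF 0 0 (d + 1) +
    U * (V * (heightGF 1 1 (d + 2) + heightGF 1 1 d)) := by
  rw [add_mul]
  unfold heightGF
  rw [X_zero_mul_mk2, X_one_mul_mk2, mk2_add, mk2_add, X_one_mul_mk2, X_zero_mul_mk2, one_eq_mk2,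
    mk2_add, mk2_add]
  refine mk2_congr fun a b => ?_
  rw [num_above_rec_rat]
  rcases a with _ | a <;> rcases b with _ | b
  all_goals simp [mul_add]
  rw [if_neg (by omega)]
  ring

theorem heightGF_odd_odd (d : ℕ) : heightGF 1 1 (d + 1) = (U + V) * heightGF 1 1 (d + 1) +
    (heightGF 0 0 (d + 2) + heightGF 0 0 d) := by
  rw [add_mul]
  unfold heightGF
  rw [X_zero_mul_mk2, X_one_mul_mk2, mk2_add, mk2_add, mk2_add]
  refine mk2_congr fun a b => ?_
  rw [num_above_rec_rat]
  rcases a with _ | a <;> rcases b with _ | b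
  all_goals simp [mul_add]
  all_goals ring_nf
  all_goals simp [add_assoc]
  omega

theorem heightGF_odd_even (d : ℕ) : heightGF 1 0 (d + 1) = 1 + (U + V) * heightGF 1 0 (d + 1) +
    V * (heightGF 0 1 (d + 2) + heightGF 0 1 d) := by
  rw [add_mul]
  unfold heightGF
  rw [X_zero_mul_mk2, X_one_mul_mk2, mk2_add, mk2_add, X_one_mul_mk2, one_eq_mk2,
    mk2_add, mk2_add]
  refine mk2_congr fun a b => ?_
  rw [num_above_rec_rat]
  rcases a with _ | a <;> rcases b with _ | b
  all_goals simp [mul_add]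
  all_goals ring_nf
  all_goals simp [add_assoc]
  omega

theorem heightGF_even_odd (d : ℕ) : heightGF 0 1 (d + 1) = 1 + (U + V) * heightGF 0 1 (d + 1) +
    U * (heightGF 1 0 (d + 2) + heightGF 1 0 d) := by
  rw [add_mul]
  unfold heightGF
  rw [X_zero_mul_mk2, X_one_mul_mk2, mk2_add, mk2_add, X_zero_mul_mk2, one_eq_mk2,
    mk2_add, mk2_add]
  refine mk2_congr fun a b => ?_
  rw [num_above_rec_rat]
  rcases a with _ | a <;> rcases b with _ | b
  all_goals simp [mul_add]
  all_goals ring_nf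
  all_goals simp [add_assoc]
  omega

/-- A linear system of this form has only the trivial solution. -/
theorem system_unique {e e' x y : MvPowerSeries (Fin 2) ℚ} (he : e' * e = 1)
    (hxy : constantCoeff (x * y) = 0) {F G : ℕ → MvPowerSeries (Fin 2) ℚ}
    (hF : ∀ d, e * F (d + 1) = x * (G (d + 2) + G d))
    (hG : ∀ d, e * G (d + 1) = y * (F (d + 2) + F d)) (hF0 : F 0 = 0) (hG0 : G 0 = 0) (d : ℕ) :
    F d = 0 := by
  have h1 : 1 ≤ (x * y).order := one_le_order_iff_constCoeff_eq_zero.2 hxy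
  have key : ∀ (k : ℕ) (d : ℕ), (k : ℕ∞) ≤ (F d).order := by
    intro k
    induction k with
    | zero => simp
    | succ k ih =>
      have hm : ∀ z w : MvPowerSeries (Fin 2) ℚ, (k : ℕ∞) ≤ w.order →
          ((k + 1 : ℕ) : ℕ∞) ≤ (z * (x * y * w)).order := by
        intro z w hw
        refine le_trans ?_ le_order_mul
        refine le_trans ?_ le_add_self
        refine le_trans ?_ le_order_mul
        rw [add_comm k 1]
        push_cast
        exact add_le_add h1 hw
      have ha : ∀ z w : MvPowerSeries (Fin 2) ℚ, (k : ℕ∞) ≤ z.order → (k : ℕ∞) ≤ w.order →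
          (k : ℕ∞) ≤ (z + w).order := fun z w hz hw =>
        le_trans (le_min hz hw) min_order_le_add
      rintro (_ | _ | d)
      · simp [hF0]
      · rw [show F (0 + 1) = e' * e' * (x * y * (F 3 + F 1)) by
          linear_combination (-(e' * e) - 1) * F 1 * he + e' ^ 2 * e * hF 0 + e' ^ 2 * x * hG 1 +
            e' ^ 2 * e * x * hG0]
        exact hm _ _ (ha _ _ (ih _) (ih _))
      · rw [show F (d + 1 + 1) = e' * e' * (x * y * ((F (d + 4) + F (d + 2)) +
            (F (d + 2) + F d))) by
          linear_combination (-(e' * e) - 1) * F (d + 2) * he + e' ^ 2 * e * hF (d + 1) +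
            e' ^ 2 * x * hG (d + 2) + e' ^ 2 * x * hG d]
        exact hm _ _ (ha _ _ (ha _ _ (ih _) (ih _)) (ha _ _ (ih _) (ih _)))
  rw [← order_eq_top_iff]
  exact ENat.eq_top_iff_forall_ge.2 fun k => key k d

theorem exists_inverse : ∃ e' : MvPowerSeries (Fin 2) ℚ, e' * (1 - U - V) = 1 :=
  ⟨(1 - U - V)⁻¹, MvPowerSeries.inv_mul_cancel _ (by simp)⟩

theorem heightGF_odd_even_eq (d : ℕ) : heightGF 1 0 d = heightGF 0 0 d + V * heightGF 1 1 d ∧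
    heightGF 0 1 d = heightGF 0 0 d + U * heightGF 1 1 d := by
  obtain ⟨e', he⟩ := exists_inverse
  have hF : ∀ d, (1 - U - V) * (heightGF 1 0 (d + 1) - heightGF 0 0 (d + 1) -
      V * heightGF 1 1 (d + 1)) = V * ((heightGF 0 1 (d + 2) - heightGF 0 0 (d + 2) -
      U * heightGF 1 1 (d + 2)) + (heightGF 0 1 d - heightGF 0 0 d - U * heightGF 1 1 d)) := by
    intro d
    linear_combination heightGF_odd_even d - heightGF_even_even d - V * heightGF_odd_odd d
  have hG : ∀ d, (1 - U - V) * (heightGF 0 1 (d + 1) - heightGF 0 0 (d + 1) -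
      U * heightGF 1 1 (d + 1)) = U * ((heightGF 1 0 (d + 2) - heightGF 0 0 (d + 2) -
      V * heightGF 1 1 (d + 2)) + (heightGF 1 0 d - heightGF 0 0 d - V * heightGF 1 1 d)) := by
    intro d
    linear_combination heightGF_even_odd d - heightGF_even_even d - U * heightGF_odd_odd d
  constructor
  · have := system_unique he (by simp)
      (F := fun d => heightGF 1 0 d - heightGF 0 0 d - V * heightGF 1 1 d)
      (G := fun d => heightGF 0 1 d - heightGF 0 0 d - U * heightGF 1 1 d)
      hF hG (by simp [heightGF_zero]) (by simp [heightGF_zero]) d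
    linear_combination this
  · have := system_unique he (by simp)
      (G := fun d => heightGF 1 0 d - heightGF 0 0 d - V * heightGF 1 1 d)
      (F := fun d => heightGF 0 1 d - heightGF 0 0 d - U * heightGF 1 1 d)
      hG hF (by simp [heightGF_zero]) (by simp [heightGF_zero]) d
    linear_combination this

theorem exists_heightGF_sqrt : ∃ Q : MvPowerSeries (Fin 2) ℚ, constantCoeff Q = 1 ∧
    Q ^ 2 = (1 - U - V) ^ 2 - 4 * U * V ∧ Q * heightGF 0 0 1 = 1 ∧
    (1 - U - V) * heightGF 0 0 1 = 1 + 2 * U * V * heightGF 1 1 1 := by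
  obtain ⟨e', he⟩ := exists_inverse
  set e := 1 - U - V with hedef
  set P : ℕ → MvPowerSeries (Fin 2) ℚ := fun d =>
    1 - e * heightGF 0 0 d + 2 * U * V * heightGF 1 1 d with hP
  set R : ℕ → MvPowerSeries (Fin 2) ℚ := fun d => 2 * heightGF 0 0 d - e * heightGF 1 1 d with hR
  have hP0 : P 0 = 1 := by simp [hP, heightGF_zero]
  have hR0 : R 0 = 0 := by simp [hR, heightGF_zero]
  have hPd : ∀ d, e * P (d + 1) = U * V * (R (d + 2) + R d) := by
    intro d
    simp only [hP, hR, hedef]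
    linear_combination -(1 - U - V) * heightGF_even_even d + 2 * U * V * heightGF_odd_odd d
  have hRd : ∀ d, e * R (d + 1) = 1 * (P (d + 2) + P d) := by
    intro d
    simp only [hP, hR, hedef]
    linear_combination -(1 - U - V) * heightGF_odd_odd d + 2 * heightGF_even_even d
  have hc : constantCoeff (U * V * 1) = (0 : ℚ) := by simp
  have hP1 : P 1 = 0 := by
    have := system_unique he hc (F := fun d => if d % 2 = 1 then P d else 0)
      (G := fun d => if d % 2 = 1 then 0 else R d) ?_ ?_ (by simp) (by simp [hR0]) 1
    · simpa using this
    · intro d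
      rcases Nat.mod_two_eq_zero_or_one d with h | h
      · simpa [Nat.add_mod, h] using hPd d
      · simp [Nat.add_mod, h]
    · intro d
      rcases Nat.mod_two_eq_zero_or_one d with h | h
      · simp [Nat.add_mod, h]
      · simpa [Nat.add_mod, h] using hRd d
  have hP2 : P 2 = U * V * R 1 ^ 2 := by
    have := system_unique he hc (F := fun d => P (d + 1) - U * V * R 1 * R d)
      (G := fun d => R (d + 1) - R 1 * P d) ?_ ?_ (by simp [hP1, hR0]) (by simp [hP0]) 1
    · linear_combination this
    · intro d
      linear_combination hPd (d + 1) - U * V * R 1 * hRd d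
    · intro d
      linear_combination hRd (d + 1) - R 1 * hPd d
  have hM : e * R 1 = 1 + U * V * R 1 ^ 2 := by
    linear_combination hRd 0 + hP2 + hP0
  refine ⟨e - 2 * U * V * R 1, by simp [hedef], by linear_combination (-4 * U * V) * hM, ?_, ?_⟩
  · have hQ : e - 2 * U * V * R 1 ≠ 0 := by
      intro h
      simpa [hedef] using congrArg constantCoeff h
    apply mul_left_cancel₀ hQ
    have hR1 : R 1 = 2 * heightGF 0 0 1 - e * heightGF 1 1 1 := rfl
    have hP1' : 1 - e * heightGF 0 0 1 + 2 * U * V * heightGF 1 1 1 = 0 := hP1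
    linear_combination (-4 * U * V) * heightGF 0 0 1 * hM - e * hP1' + 2 * U * V * hR1
  · have hP1' : 1 - e * heightGF 0 0 1 + 2 * U * V * heightGF 1 1 1 = 0 := hP1
    linear_combination -hP1'

end SimpleAvInv

namespace SimpleAvInv

open MvPowerSeries

/-- The coefficients of a series multiplied by the first variable. -/
def shiftLeft (s : ℕ → ℕ → ℚ) : ℕ → ℕ → ℚ
  | 0, _ => 0
  | a + 1, b => s a b

/-- The coefficients of a series multiplied by the second variable. -/
def shiftRight (s : ℕ → ℕ → ℚ) : ℕ → ℕ → ℚ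
  | _, 0 => 0
  | a, b + 1 => s a b

/-- The coefficients of a constant series. -/
def pointAt (t : ℚ) : ℕ → ℕ → ℚ
  | 0, 0 => t
  | _, _ => 0

theorem mk2_shiftLeft (s : ℕ → ℕ → ℚ) : mk2 (shiftLeft s) = X 0 * mk2 s := by
  rw [X_zero_mul_mk2]
  refine mk2_congr fun a b => ?_
  cases a <;> simp [shiftLeft]

theorem mk2_shiftRight (s : ℕ → ℕ → ℚ) : mk2 (shiftRight s) = X 1 * mk2 s := by
  rw [X_one_mul_mk2]
  refine mk2_congr fun a b => ?_
  cases b <;> simp [shiftRight]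

theorem mk2_pointAt (t : ℚ) : mk2 (pointAt t) = C t := by
  rw [← mul_one (C t), one_eq_mk2]
  ext m
  rw [coeff_C_mul, coeff_mk2, coeff_mk2]
  rcases m 0 with _ | a <;> rcases m 1 with _ | b <;> simp [pointAt]

theorem eq_pointAt_add (s : ℕ → ℕ → ℚ) : s = pointAt (s 0 0) + (shiftLeft (fun a b => s (a + 1) b) +
    shiftRight fun a b => if a = 0 then s 0 (b + 1) else 0) := by
  funext a b
  rcases a with _ | a <;> rcases b with _ | b <;> simp [pointAt, shiftLeft, shiftRight]

/-- A substitution homomorphism in two variables is determined by its algebraic properties. -/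
theorem eq_subst_mk2 {τ : Type} {x y : MvPowerSeries τ ℚ} (hx : constantCoeff x = 0)
    (hy : constantCoeff y = 0) {H : (ℕ → ℕ → ℚ) → MvPowerSeries τ ℚ}
    (hadd : ∀ s t, H (s + t) = H s + H t) (hl : ∀ s, H (shiftLeft s) = x * H s)
    (hr : ∀ s, H (shiftRight s) = y * H s) (h0 : ∀ t, H (pointAt t) = C t) (s : ℕ → ℕ → ℚ) :
    H s = subst ![x, y] (mk2 s) := by
  have ha : HasSubst ![x, y] := hasSubst_of_constantCoeff_zero fun i => by
    fin_cases i <;> simp [hx, hy]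
  have key : ∀ (k : ℕ) (s : ℕ → ℕ → ℚ), (k : ℕ∞) ≤ (H s - subst ![x, y] (mk2 s)).order := by
    intro k
    induction k with
    | zero => simp
    | succ k ih =>
      intro s
      have e : H s - subst ![x, y] (mk2 s) =
          x * (H (fun a b => s (a + 1) b) - subst ![x, y] (mk2 fun a b => s (a + 1) b)) +
          y * (H (fun a b => if a = 0 then s 0 (b + 1) else 0) -
            subst ![x, y] (mk2 fun a b => if a = 0 then s 0 (b + 1) else 0)) := by
        conv_lhs => rw [eq_pointAt_add s]
        rw [hadd, hadd, hl, hr, h0, show mk2 (pointAt (s 0 0) +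
          (shiftLeft (fun a b => s (a + 1) b) +
          shiftRight fun a b => if a = 0 then s 0 (b + 1) else 0)) = mk2 (pointAt (s 0 0)) +
          (mk2 (shiftLeft (fun a b => s (a + 1) b)) +
          mk2 (shiftRight fun a b => if a = 0 then s 0 (b + 1) else 0)) from rfl,
          mk2_pointAt, mk2_shiftLeft, mk2_shiftRight, subst_add ha, subst_add ha, subst_mul ha,
          subst_mul ha, subst_X ha, subst_X ha, subst_C]
        simp
        ring
      rw [e]
      have hm : ∀ z w : MvPowerSeries τ ℚ, constantCoeff z = 0 → (k : ℕ∞) ≤ w.order →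
          ((k + 1 : ℕ) : ℕ∞) ≤ (z * w).order := by
        intro z w hz hw
        refine le_trans ?_ le_order_mul
        rw [add_comm k 1]
        push_cast
        exact add_le_add (one_le_order_iff_constCoeff_eq_zero.2 hz) hw
      exact le_trans (le_min (hm _ _ hx (ih _)) (hm _ _ hy (ih _))) min_order_le_add
  rw [← sub_eq_zero, ← order_eq_top_iff]
  exact ENat.eq_top_iff_forall_ge.2 fun k => key k s

/-- The double binomial transform. -/
noncomputable def binom2 (s : ℕ → ℕ → ℚ) (c d : ℕ) : ℚ :=
  ∑ i ∈ Finset.range (c + 1), ∑ j ∈ Finset.range (d + 1), (c.choose i : ℚ) * d.choose j * s i j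

theorem binom2_add (s t : ℕ → ℕ → ℚ) : binom2 (s + t) = binom2 s + binom2 t := by
  funext c d
  simp only [binom2, Pi.add_apply, mul_add, Finset.sum_add_distrib]

theorem sum_choose_shift {f g : ℕ → ℚ} (h0 : f 0 = 0) (hs : ∀ i, f (i + 1) = g i) (c : ℕ) :
    ∑ i ∈ Finset.range (c + 1 + 1), ((c + 1).choose i : ℚ) * f i =
      ∑ i ∈ Finset.range (c + 1), (c.choose i : ℚ) * f i +
      ∑ i ∈ Finset.range (c + 1), (c.choose i : ℚ) * g i := by
  have h : ∑ i ∈ Finset.range (c + 1), (c.choose (i + 1) : ℚ) * g i =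
      ∑ i ∈ Finset.range (c + 1), (c.choose i : ℚ) * f i := by
    rw [Finset.sum_range_succ, Finset.sum_range_succ' _ c]
    simp [h0, hs]
  rw [Finset.sum_range_succ', h0, ← h, ← Finset.sum_add_distrib, mul_zero, add_zero]
  refine Finset.sum_congr rfl fun i _ => ?_
  rw [hs, Nat.choose_succ_succ]
  push_cast
  ring

theorem binom2_shiftLeft (s : ℕ → ℕ → ℚ) (c d : ℕ) :
    binom2 (shiftLeft s) (c + 1) d = binom2 (shiftLeft s) c d + binom2 s c d := by
  unfold binom2
  simp only [mul_assoc, ← Finset.mul_sum]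
  exact sum_choose_shift (by simp [shiftLeft]) (fun i => rfl) c

theorem binom2_shiftRight (s : ℕ → ℕ → ℚ) (c d : ℕ) :
    binom2 (shiftRight s) c (d + 1) = binom2 (shiftRight s) c d + binom2 s c d := by
  unfold binom2
  rw [← Finset.sum_add_distrib]
  refine Finset.sum_congr rfl fun i _ => ?_
  simp only [mul_assoc, ← Finset.mul_sum]
  rw [sum_choose_shift (g := s i) (by simp [shiftRight]) (fun j => by simp [shiftRight]), mul_add]

theorem binom2_pointAt (t : ℚ) (c d : ℕ) : binom2 (pointAt t) c d = t := by
  unfold binom2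
  rw [Finset.sum_range_succ', Finset.sum_range_succ' _ d]
  simp [pointAt]

local notation "U" => (X 0 : MvPowerSeries (Fin 2) ℚ)
local notation "V" => (X 1 : MvPowerSeries (Fin 2) ℚ)

theorem one_sub_inv_mul (i : Fin 2) :
    (1 - X i : MvPowerSeries (Fin 2) ℚ)⁻¹ * (1 - X i) = 1 :=
  MvPowerSeries.inv_mul_cancel _ (by simp)

theorem one_add_inv_mul (i : Fin 2) :
    (1 + X i ^ 2 : MvPowerSeries (Fin 2) ℚ)⁻¹ * (1 + X i ^ 2) = 1 :=
  MvPowerSeries.inv_mul_cancel _ (by simp)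

theorem mk2_binom2 (s : ℕ → ℕ → ℚ) : (1 - U) * ((1 - V) * mk2 (binom2 s)) =
    subst ![U * (1 - U)⁻¹, V * (1 - V)⁻¹] (mk2 s) := by
  refine eq_subst_mk2 (H := fun s => (1 - U) * ((1 - V) * mk2 (binom2 s))) (by simp) (by simp)
    ?_ ?_ ?_ ?_ s
  · intro s t
    rw [binom2_add, show mk2 (binom2 s + binom2 t) = mk2 (binom2 s) + mk2 (binom2 t) from rfl]
    ring
  · intro s
    have h : (1 - U) * mk2 (binom2 (shiftLeft s)) = U * mk2 (binom2 s) := by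
      rw [sub_mul, one_mul, X_zero_mul_mk2, X_zero_mul_mk2, mk2_sub]
      refine mk2_congr fun a b => ?_
      rcases a with _ | a
      · simp [binom2, shiftLeft]
      · simp [binom2_shiftLeft]
    linear_combination (1 - V) * h - U * ((1 - V) * mk2 (binom2 s)) * one_sub_inv_mul 0
  · intro s
    have h : (1 - V) * mk2 (binom2 (shiftRight s)) = V * mk2 (binom2 s) := by
      rw [sub_mul, one_mul, X_one_mul_mk2, X_one_mul_mk2, mk2_sub]
      refine mk2_congr fun a b => ?_
      rcases b with _ | b
      · simp [binom2, shiftRight]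
      · simp [binom2_shiftRight]
    linear_combination (1 - U) * h - V * ((1 - U) * mk2 (binom2 s)) * one_sub_inv_mul 1
  · intro t
    have : mk2 (binom2 (pointAt t)) = mk2 fun _ _ => t := mk2_congr (binom2_pointAt t)
    rw [this, sub_mul 1 V, one_mul, X_one_mul_mk2, mk2_sub, sub_mul 1 U, one_mul, X_zero_mul_mk2,
      mk2_sub, ← mk2_pointAt]
    refine mk2_congr fun a b => ?_
    rcases a with _ | a <;> rcases b with _ | b <;> simp [pointAt]

/-- The substitution inverting the binomial transform, in terms of the squares of variables. -/
noncomputable def shrink : MvPowerSeries (Fin 2) ℚ →ₐ[ℚ] MvPowerSeries (Fin 2) ℚ :=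
  substAlgHom (a := ![U ^ 2 * (1 + U ^ 2)⁻¹, V ^ 2 * (1 + V ^ 2)⁻¹])
    (hasSubst_of_constantCoeff_zero fun i => by fin_cases i <;> simp)

theorem shrink_X (i : Fin 2) : shrink (X i) = X i ^ 2 * (1 + X i ^ 2)⁻¹ := by
  rw [shrink, substAlgHom_X]
  fin_cases i <;> rfl

theorem shrink_mul_inv (i : Fin 2) : shrink (X i * (1 - X i)⁻¹) = X i ^ 2 := by
  have h := congrArg shrink (one_sub_inv_mul i)
  rw [map_mul, map_sub, map_one, shrink_X] at h
  rw [map_mul, shrink_X]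
  have h1 := one_add_inv_mul i
  linear_combination X i ^ 2 * h + X i ^ 2 * shrink ((1 - X i)⁻¹) * h1

theorem shrink_binom2 (s : ℕ → ℕ → ℚ) : shrink (mk2 (binom2 s)) =
    (1 + U ^ 2) * ((1 + V ^ 2) * expand 2 two_ne_zero (mk2 s)) := by
  have ha : HasSubst ![U * (1 - U)⁻¹, V * (1 - V)⁻¹] :=
    hasSubst_of_constantCoeff_zero fun i => by fin_cases i <;> simp
  have h := congrArg shrink (mk2_binom2 s)
  have e : shrink (subst ![U * (1 - U)⁻¹, V * (1 - V)⁻¹] (mk2 s)) =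
      expand 2 two_ne_zero (mk2 s) := by
    have hb : HasSubst ![U ^ 2 * (1 + U ^ 2)⁻¹, V ^ 2 * (1 + V ^ 2)⁻¹] :=
      hasSubst_of_constantCoeff_zero fun i => by fin_cases i <;> simp
    have h0 := shrink_mul_inv 0
    have h1 := shrink_mul_inv 1
    rw [shrink, substAlgHom_apply] at h0 h1 ⊢
    rw [subst_comp_subst_apply ha hb, expand, substAlgHom_apply]
    congr 1
    funext i
    fin_cases i
    · exact h0
    · exact h1
  rw [e, map_mul, map_mul, map_sub, map_sub, map_one, shrink_X, shrink_X] at h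
  have h0 := one_add_inv_mul 0
  have h1 := one_add_inv_mul 1
  set a := (1 + U ^ 2)⁻¹
  set b := (1 + V ^ 2)⁻¹
  rw [show 1 - U ^ 2 * a = a by linear_combination -h0,
    show 1 - V ^ 2 * b = b by linear_combination -h1] at h
  rw [← h]
  linear_combination (-shrink (mk2 (binom2 s))) * (h0 * (b * (1 + V ^ 2))) -
    shrink (mk2 (binom2 s)) * h1

/-- The generating function of simple words with parities prescribed. -/
noncomputable def wordGF (i j : ℕ) : MvPowerSeries (Fin 2) ℚ :=
  mk2 fun a b => if a % 2 = i % 2 ∧ b % 2 = j % 2 then (num SimpleWord a b : ℚ) else 0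

theorem expand_mk2 (f : ℕ → ℕ → ℚ) : expand 2 two_ne_zero (mk2 f) =
    mk2 fun a b => if a % 2 = 0 ∧ b % 2 = 0 then f (a / 2) (b / 2) else 0 := by
  ext m
  rw [coeff_mk2]
  split_ifs with h
  · obtain ⟨k, rfl⟩ : ∃ k : Fin 2 →₀ ℕ, m = 2 • k := by
      refine ⟨m.mapRange (· / 2) rfl, Finsupp.ext fun i => ?_⟩
      have : m i % 2 = 0 := by
        fin_cases i
        · exact h.1
        · exact h.2
      simp
      omega
    rw [coeff_expand_smul, coeff_mk2]
    simp
  · obtain ⟨i, hi⟩ : ∃ i : Fin 2, ¬ 2 ∣ m i := by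
      by_contra hc
      push Not at hc
      exact h ⟨Nat.mod_eq_zero_of_dvd (hc 0), Nat.mod_eq_zero_of_dvd (hc 1)⟩
    exact coeff_expand_of_not_dvd _ _ _ hi

theorem num_indec_zero_left (q : ℕ) (P : List Bool → Prop) :
    num (fun w => Indec w ∧ P w) 0 q = 0 := by
  rw [num, Set.ncard_eq_zero (wordSet_finite _ _ _)]
  ext w
  simp only [mem_wordSet, Set.mem_empty_iff_false, iff_false]
  rintro ⟨⟨h, -⟩, h0, -⟩
  obtain ⟨z, rfl, -⟩ := indec_iff_ends.1 h
  simp at h0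

theorem num_indec_zero_right (p : ℕ) (P : List Bool → Prop) :
    num (fun w => Indec w ∧ P w) p 0 = 0 := by
  rw [num, Set.ncard_eq_zero (wordSet_finite _ _ _)]
  ext w
  simp only [mem_wordSet, Set.mem_empty_iff_false, iff_false]
  rintro ⟨⟨h, -⟩, -, h0⟩
  obtain ⟨z, rfl, -⟩ := indec_iff_ends.1 h
  simp at h0

theorem wordGF_eq (e e' : Bool) : wordGF (1 + e.toNat) (1 + e'.toNat) =
    U ^ (1 + e.toNat) * (V ^ (1 + e'.toNat) * expand 2 two_ne_zero
      (mk2 fun c d => (num SimpleWord (2 * c + 1 + e.toNat) (2 * d + 1 + e'.toNat) : ℚ))) := by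
  have hl : ∀ q, num SimpleWord 0 q = 0 := fun q => num_indec_zero_left q _
  have hr : ∀ p, num SimpleWord p 0 = 0 := fun p => num_indec_zero_right p _
  rw [expand_mk2]
  cases e <;> cases e' <;> simp only [Bool.toNat_true, Bool.toNat_false, add_zero, pow_one,
    Nat.reduceAdd, pow_two, mul_assoc, X_one_mul_mk2, X_zero_mul_mk2] <;> unfold wordGF <;>
    refine mk2_congr fun a b => ?_
  all_goals
    rcases Nat.eq_zero_or_pos a with rfl | ha
    · simp [hl]
    rcases Nat.eq_zero_or_pos b with rfl | hb
    · simp [hr]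
    split_ifs <;> first | rfl | (exfalso; omega) | (congr 2 <;> omega)

end SimpleAvInv

namespace SimpleAvInv

open MvPowerSeries

local notation "U" => (X 0 : MvPowerSeries (Fin 2) ℚ)
local notation "V" => (X 1 : MvPowerSeries (Fin 2) ℚ)

theorem wordGF_shrink (e e' : Bool) :
    (1 + U ^ 2) * (1 + V ^ 2) * wordGF (1 + e.toNat) (1 + e'.toNat) =
      U ^ (1 + e.toNat) * V ^ (1 + e'.toNat) * shrink (mk2 fun c d =>
        parityPart e (fun p => parityPart e' (fun q => (num Indec p q : ℚ)) d) c) := by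
  have h := shrink_binom2 fun c d =>
    (num SimpleWord (2 * c + 1 + e.toNat) (2 * d + 1 + e'.toNat) : ℚ)
  rw [wordGF_eq, mk2_congr (parityPart_parityPart_num e e')]
  have h' : shrink (mk2 fun c d => ∑ i ∈ Finset.range (c + 1), ∑ j ∈ Finset.range (d + 1),
      (c.choose i : ℚ) * d.choose j *
        num SimpleWord (2 * i + 1 + e.toNat) (2 * j + 1 + e'.toNat)) = _ := h
  rw [h']
  ring

theorem mk2_parityPart_num (e e' : Bool) :
    (mk2 fun c d =>
      parityPart e (fun p => parityPart e' (fun q => (num Indec p q : ℚ)) d) c) =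
    if e then
      if e' then (1 - U - V) * heightGF 1 1 1 - heightGF 0 0 1 else V * heightGF 1 1 1
    else if e' then U * heightGF 1 1 1 else heightGF 0 0 1 := by
  obtain ⟨h10, h01⟩ := heightGF_odd_even_eq 1
  have e1 : heightGF 1 0 1 - heightGF 0 0 1 = V * heightGF 1 1 1 := by rw [h10]; ring
  have e2 : heightGF 0 1 1 - heightGF 0 0 1 = U * heightGF 1 1 1 := by rw [h01]; ring
  have e3 : (heightGF 1 1 1 - heightGF 1 0 1) - (heightGF 0 1 1 - heightGF 0 0 1) =
      (1 - U - V) * heightGF 1 1 1 - heightGF 0 0 1 := by rw [h01, h10]; ring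
  cases e <;> cases e' <;> simp only [parityPart, Bool.false_eq_true, if_false, if_true]
  · exact mk2_congr fun a b => by rw [num_indec_succ]; rfl
  · rw [← e2, heightGF, heightGF, mk2_sub]
    exact mk2_congr fun a b => by simp only [num_indec_succ]; rfl
  · rw [← e1, heightGF, heightGF, mk2_sub]
    exact mk2_congr fun a b => by simp only [num_indec_succ]; rfl
  · rw [← e3, heightGF, heightGF, heightGF, heightGF, mk2_sub, mk2_sub, mk2_sub]
    refine mk2_congr fun a b => ?_
    simp only [num_indec_succ, add_zero]

theorem exists_wordGF_sqrt : ∃ r : MvPowerSeries (Fin 2) ℚ, constantCoeff r = 1 ∧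
    r ^ 2 = 1 - 6 * U ^ 2 * V ^ 2 - 4 * U ^ 2 * V ^ 4 - 4 * U ^ 4 * V ^ 2 - 3 * U ^ 4 * V ^ 4 ∧
    wordGF 1 1 * r = U * V ∧
    2 * (1 + V ^ 2) * wordGF 2 1 * r = V * (1 - U ^ 2 * V ^ 2 - r) ∧
    2 * (1 + U ^ 2) * wordGF 1 2 * r = U * (1 - U ^ 2 * V ^ 2 - r) ∧
    4 * ((1 + U ^ 2) * (1 + V ^ 2)) * wordGF 2 2 * r = (1 - U ^ 2 * V ^ 2 - r) ^ 2 := by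
  obtain ⟨Q, -, hQ2, hQA, hD⟩ := exists_heightGF_sqrt
  set A := heightGF 0 0 1 with hA
  set D := heightGF 1 1 1 with hDd
  have hQ : Q = 1 - U - V - 2 * U * V * D * Q := by
    linear_combination (1 - U - V) * hQA - Q * hD
  have h0 := one_add_inv_mul 0
  have h1 := one_add_inv_mul 1
  set a : MvPowerSeries (Fin 2) ℚ := (1 + X 0 ^ 2)⁻¹
  set b : MvPowerSeries (Fin 2) ℚ := (1 + X 1 ^ 2)⁻¹
  have s0 : shrink U = U ^ 2 * a := shrink_X 0
  have s1 : shrink V = V ^ 2 * b := shrink_X 1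
  have g00 := wordGF_shrink false false
  have g10 := wordGF_shrink true false
  have g01 := wordGF_shrink false true
  have g11 := wordGF_shrink true true
  simp only [mk2_parityPart_num, Bool.toNat_true, Bool.toNat_false, add_zero, Nat.reduceAdd,
    Bool.false_eq_true, if_true, if_false, pow_one, map_mul, map_sub, map_one, s0, s1, ← hA,
    ← hDd] at g00 g10 g01 g11
  have hQ' := congrArg shrink hQ
  have hQ2' := congrArg shrink hQ2
  have hQA' := congrArg shrink hQA
  simp only [map_mul, map_sub, map_one, map_pow, map_ofNat, s0, s1] at hQ' hQ2' hQA'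
  set q := shrink Q
  set A' := shrink A
  set D' := shrink D
  have hr : (1 + U ^ 2) * (1 + V ^ 2) * q = 1 - U ^ 2 * V ^ 2 - 2 * U ^ 2 * V ^ 2 * D' * q := by
    linear_combination (1 + U ^ 2) * (1 + V ^ 2) * hQ' - (1 + V ^ 2) * U ^ 2 * h0 -
      (1 + U ^ 2) * V ^ 2 * h1 -
      2 * U ^ 2 * V ^ 2 * D' * q * (h0 * (b * (1 + V ^ 2)) + h1)
  have hm : (1 + U ^ 2) * (1 + V ^ 2) * (1 - U ^ 2 * a - V ^ 2 * b) = 1 - U ^ 2 * V ^ 2 := by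
    linear_combination -(1 + V ^ 2) * U ^ 2 * h0 - (1 + U ^ 2) * V ^ 2 * h1
  have hr2 : ((1 + U ^ 2) * (1 + V ^ 2) * q) ^ 2 = (1 - U ^ 2 * V ^ 2) ^ 2 -
      4 * U ^ 2 * V ^ 2 * ((1 + U ^ 2) * (1 + V ^ 2)) := by
    rw [mul_pow, hQ2', ← hm]
    linear_combination -4 * U ^ 2 * V ^ 2 * ((1 + U ^ 2) * (1 + V ^ 2)) *
      (h0 * (b * (1 + V ^ 2)) + h1)
  refine ⟨(1 + U ^ 2) * (1 + V ^ 2) * q, ?_, ?_, ?_, ?_, ?_, ?_⟩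
  · rw [hr]; simp
  · rw [hr2]; ring
  · linear_combination q * g00 + U * V * hQA'
  · linear_combination 2 * (1 + V ^ 2) * q * g10 + V * hr + 2 * U ^ 2 * V ^ 3 * D' * q * h1
  · linear_combination 2 * (1 + U ^ 2) * q * g01 + U * hr + 2 * U ^ 3 * V ^ 2 * D' * q * h0
  · linear_combination 4 * ((1 + U ^ 2) * (1 + V ^ 2)) * q * g11 - hr2 +
      4 * U ^ 2 * V ^ 2 * D' * q * hm -
      4 * U ^ 2 * V ^ 2 * ((1 + U ^ 2) * (1 + V ^ 2)) * hQA' + 2 * (1 - U ^ 2 * V ^ 2) * hr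

end SimpleAvInv

namespace SimpleAvInv

open MvPowerSeries

local notation "U" => (X 0 : MvPowerSeries (Fin 2) ℚ)
local notation "V" => (X 1 : MvPowerSeries (Fin 2) ℚ)

theorem closed_forms : ∃ r : MvPowerSeries (Fin 2) ℚ, constantCoeff r = 1 ∧
    r ^ 2 = 1 - 6 * U ^ 2 * V ^ 2 - 4 * U ^ 2 * V ^ 4 - 4 * U ^ 4 * V ^ 2 - 3 * U ^ 4 * V ^ 4 ∧
    wordGF 2 2 = 2 * U ^ 2 * V ^ 4 * (1 + U ^ 2) * (1 + 2 * U ^ 2 + U ^ 2 * V ^ 2 - r) *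
      ((1 - U ^ 2 * V ^ 2 + r) *
        (1 - 6 * U ^ 2 * V ^ 2 - 4 * U ^ 2 * V ^ 4 - 4 * U ^ 4 * V ^ 2 - 3 * U ^ 4 * V ^ 4
          + (1 + 2 * V ^ 2 + U ^ 2 * V ^ 2) * r))⁻¹ ∧
    wordGF 2 1 = U ^ 2 * V ^ 3 * (1 + U ^ 2) * (1 + 2 * V ^ 2 + U ^ 2 * V ^ 2 + r) *
      ((1 + V ^ 2) *
        (1 - 6 * U ^ 2 * V ^ 2 - 4 * U ^ 2 * V ^ 4 - 4 * U ^ 4 * V ^ 2 - 3 * U ^ 4 * V ^ 4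
          + (1 - 3 * U ^ 2 * V ^ 2 - 2 * U ^ 4 * V ^ 2) * r))⁻¹ ∧
    wordGF 1 2 = V ^ 2 * U ^ 3 * (1 + V ^ 2) * (1 + 2 * U ^ 2 + V ^ 2 * U ^ 2 + r) *
      ((1 + U ^ 2) *
        (1 - 6 * V ^ 2 * U ^ 2 - 4 * V ^ 2 * U ^ 4 - 4 * V ^ 4 * U ^ 2 - 3 * V ^ 4 * U ^ 4
          + (1 - 3 * V ^ 2 * U ^ 2 - 2 * V ^ 4 * U ^ 2) * r))⁻¹ ∧
    wordGF 1 1 - U * V = U * V ^ 3 *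
        (2 + 7 * U ^ 2 + 4 * U ^ 2 * V ^ 2 + 4 * U ^ 4 + 3 * U ^ 4 * V ^ 2 - (2 + U ^ 2) * r) *
        (1 - 6 * U ^ 2 * V ^ 2 - 4 * U ^ 2 * V ^ 4 - 4 * U ^ 4 * V ^ 2 - 3 * U ^ 4 * V ^ 4
          + (1 + 2 * V ^ 2 + U ^ 2 * V ^ 2) * r)⁻¹ := by
  obtain ⟨r, hr, hr2, h11, h21, h12, h22⟩ := exists_wordGF_sqrt
  have ne {F : MvPowerSeries (Fin 2) ℚ} (h : constantCoeff F ≠ 0) : F ≠ 0 := by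
    rintro rfl
    simp at h
  refine ⟨r, hr, hr2, ?_, ?_, ?_, ?_⟩
  · rw [MvPowerSeries.eq_mul_inv_iff_mul_eq (by simp [hr])]
    refine mul_left_cancel₀ (ne (F := 4 * ((1 + U ^ 2) * (1 + V ^ 2)))
      (by rw [map_mul, map_ofNat]; simp)) ?_
    have e : (1 - U ^ 2 * V ^ 2 - r) * (1 - U ^ 2 * V ^ 2 + r) =
        4 * U ^ 2 * V ^ 2 * ((1 + U ^ 2) * (1 + V ^ 2)) := by linear_combination -hr2
    have e' : (1 - U ^ 2 * V ^ 2 - r) * (1 + 2 * V ^ 2 + U ^ 2 * V ^ 2 + r) =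
        2 * V ^ 2 * (1 + U ^ 2) * (1 + 2 * U ^ 2 + U ^ 2 * V ^ 2 - r) := by
      linear_combination -hr2
    rw [← hr2]
    linear_combination (1 - U ^ 2 * V ^ 2 + r) * (1 + 2 * V ^ 2 + U ^ 2 * V ^ 2 + r) * h22 +
      (1 - U ^ 2 * V ^ 2 - r) * (1 + 2 * V ^ 2 + U ^ 2 * V ^ 2 + r) * e +
      4 * U ^ 2 * V ^ 2 * ((1 + U ^ 2) * (1 + V ^ 2)) * e'
  · rw [MvPowerSeries.eq_mul_inv_iff_mul_eq (by simp [hr])]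
    refine mul_left_cancel₀ (ne (F := 2) (by rw [map_ofNat]; simp)) ?_
    rw [← hr2]
    linear_combination (r + 1 - 3 * U ^ 2 * V ^ 2 - 2 * U ^ 4 * V ^ 2) * h21 - V * hr2
  · rw [MvPowerSeries.eq_mul_inv_iff_mul_eq (by simp [hr])]
    refine mul_left_cancel₀ (ne (F := 2) (by rw [map_ofNat]; simp)) ?_
    linear_combination (r + 1 - 3 * V ^ 2 * U ^ 2 - 2 * V ^ 4 * U ^ 2) * h12 - U * hr2 -
      2 * (1 + U ^ 2) * wordGF 1 2 * hr2
  · rw [MvPowerSeries.eq_mul_inv_iff_mul_eq (by simp [hr])]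
    rw [← hr2]
    linear_combination (1 + 2 * V ^ 2 + U ^ 2 * V ^ 2 + r) * h11 - U * V * hr2

/-- The substitution of one variable for both variables. -/
noncomputable def diag : MvPowerSeries (Fin 2) ℚ →ₐ[ℚ] PowerSeries ℚ :=
  substAlgHom (a := ![PowerSeries.X, PowerSeries.X])
    (hasSubst_of_constantCoeff_zero fun i => by
      fin_cases i <;> exact PowerSeries.constantCoeff_X)

theorem diag_X (i : Fin 2) : diag (X i) = PowerSeries.X := by
  unfold diag
  rw [coe_substAlgHom, subst_X]
  · fin_cases i <;> rfl
  · exact hasSubst_of_constantCoeff_zero fun i => by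
      fin_cases i <;> exact PowerSeries.constantCoeff_X

theorem diag_mk2 (s : ℕ → ℕ → ℚ) : diag (mk2 s) =
    PowerSeries.mk fun n => ∑ p ∈ Finset.HasAntidiagonal.antidiagonal n, s p.1 p.2 := by
  unfold diag
  rw [coe_substAlgHom]
  symm
  refine eq_subst_mk2 (H := fun s => PowerSeries.mk fun n =>
    ∑ p ∈ Finset.HasAntidiagonal.antidiagonal n, s p.1 p.2) PowerSeries.constantCoeff_X
    PowerSeries.constantCoeff_X ?_ ?_ ?_ ?_ s
  · intro s t
    ext n
    simp [Finset.sum_add_distrib]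
  · intro s
    refine PowerSeries.ext fun n => ?_
    change _ = PowerSeries.coeff n (PowerSeries.X * _)
    rcases n with _ | n
    · simp [shiftLeft]
    · rw [PowerSeries.coeff_succ_X_mul]
      simp [Finset.Nat.antidiagonal_succ, shiftLeft]
  · intro s
    refine PowerSeries.ext fun n => ?_
    change _ = PowerSeries.coeff n (PowerSeries.X * _)
    rcases n with _ | n
    · simp [shiftRight]
    · rw [PowerSeries.coeff_succ_X_mul]
      simp [Finset.Nat.antidiagonal_succ', shiftRight]
  · intro t
    refine PowerSeries.ext fun n => ?_
    change _ = PowerSeries.coeff n (PowerSeries.C t)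
    rcases n with _ | n
    · simp [pointAt]
    · rw [PowerSeries.coeff_C, if_neg n.succ_ne_zero, PowerSeries.coeff_mk]
      refine Finset.sum_eq_zero fun p hp => ?_
      rcases p with ⟨_ | a, _ | b⟩ <;> simp [pointAt] at hp ⊢

theorem diag_closed_forms : ∃ q : PowerSeries ℚ, PowerSeries.constantCoeff q = 1 ∧
    q ^ 2 = 1 - 2 * PowerSeries.X ^ 2 - 3 * PowerSeries.X ^ 4 ∧
    diag (wordGF 2 2) = 2 * PowerSeries.X ^ 6 * (1 + PowerSeries.X ^ 2 - q) *
      (2 - 2 * PowerSeries.X ^ 2 - 10 * PowerSeries.X ^ 4 - 6 * PowerSeries.X ^ 6 +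
        (2 - 6 * PowerSeries.X ^ 4 - 4 * PowerSeries.X ^ 6) * q)⁻¹ ∧
    diag (wordGF 2 1) + diag (wordGF 1 2) =
      2 * PowerSeries.X ^ 5 * (1 + PowerSeries.X ^ 2 + q) *
        ((1 + PowerSeries.X ^ 2) ^ 2 *
          (1 - 3 * PowerSeries.X ^ 2 + (1 - 2 * PowerSeries.X ^ 2) * q))⁻¹ ∧
    diag (wordGF 1 1 - U * V) =
      PowerSeries.X ^ 4 * (2 + 5 * PowerSeries.X ^ 2 + 3 * PowerSeries.X ^ 4 -
        (2 + PowerSeries.X ^ 2) * q) *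
        (1 - PowerSeries.X ^ 2 - 5 * PowerSeries.X ^ 4 - 3 * PowerSeries.X ^ 6 +
          (1 + 2 * PowerSeries.X ^ 2 + PowerSeries.X ^ 4) * q)⁻¹ := by
  obtain ⟨r, hr, hr2, h11, h21, h12, h22⟩ := exists_wordGF_sqrt
  have ne {F : PowerSeries ℚ} (h : PowerSeries.constantCoeff F ≠ 0) : F ≠ 0 := by
    rintro rfl
    simp at h
  have e := congrArg diag hr2
  have e11 := congrArg diag h11
  have e21 := congrArg diag h21
  have e12 := congrArg diag h12
  have e22 := congrArg diag h22
  simp only [map_mul, map_sub, map_add, map_one, map_pow, map_ofNat, diag_X] at e e11 e21 e12 e22 ⊢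
  have hc : PowerSeries.constantCoeff (diag r) = 1 := by
    rw [eq_mk2 r, diag_mk2]
    simpa using hr
  generalize hx : (PowerSeries.X : PowerSeries ℚ) = x at *
  have hx0 : PowerSeries.constantCoeff x = 0 := by rw [← hx, PowerSeries.constantCoeff_X]
  have hk : (1 + x ^ 2 : PowerSeries ℚ)⁻¹ * (1 + x ^ 2) = 1 :=
    PowerSeries.inv_mul_cancel _ (by simp [hx0])
  have hk0 : (1 + x ^ 2 : PowerSeries ℚ) ≠ 0 := ne (by simp [hx0])
  have c2 : PowerSeries.constantCoeff (2 : PowerSeries ℚ) = 2 := map_ofNat _ 2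
  have two : (2 : PowerSeries ℚ) ≠ 0 := ne (by simp [c2])
  obtain ⟨q, hq⟩ : ∃ q, diag r = (1 + x ^ 2) * q :=
    ⟨(1 + x ^ 2)⁻¹ * diag r, by linear_combination -diag r * hk⟩
  rw [hq] at e e11 e21 e12 e22 hc
  have hqc : PowerSeries.constantCoeff q = 1 := by simpa [hx0] using hc
  have hq2 : q ^ 2 = 1 - 2 * x ^ 2 - 3 * x ^ 4 := by
    refine mul_left_cancel₀ (pow_ne_zero 2 hk0) ?_
    linear_combination e
  have f22 : 4 * (1 + x ^ 2) * diag (wordGF 2 2) * q = (1 - x ^ 2 - q) ^ 2 := by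
    refine mul_left_cancel₀ (pow_ne_zero 2 hk0) ?_
    linear_combination e22
  have f1 : (1 + x ^ 2) * (diag (wordGF 2 1) + diag (wordGF 1 2)) * q = x * (1 - x ^ 2 - q) := by
    refine mul_left_cancel₀ hk0 (mul_left_cancel₀ two ?_)
    linear_combination e21 + e12
  refine ⟨q, hqc, hq2, ?_, ?_, ?_⟩
  · rw [PowerSeries.eq_mul_inv_iff_mul_eq (by simp [hqc, hx0, c2])]
    refine mul_left_cancel₀ two ?_
    linear_combination (q + (1 - x ^ 2 - 2 * x ^ 4)) * f22 +
      4 * (1 + x ^ 2) * diag (wordGF 2 2) * (-hq2) + (q + (-1 + x ^ 2 - 2 * x ^ 4)) * hq2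
  · rw [PowerSeries.eq_mul_inv_iff_mul_eq (by simp [hqc, hx0])]
    linear_combination (q + (1 - x ^ 2 - 2 * x ^ 4)) * f1 - x * hq2 -
      (1 + x ^ 2) * (diag (wordGF 2 1) + diag (wordGF 1 2)) * hq2
  · rw [PowerSeries.eq_mul_inv_iff_mul_eq (by simp [hqc, hx0])]
    linear_combination (q + (1 + x ^ 2)) * e11 - (1 + x ^ 2) * diag (wordGF 1 1) * hq2

end SimpleAvInv

namespace SimpleAvInv

/-- The number of indices below `t` at which `f` takes the value `y`. -/
def rank {n : ℕ} (f : Fin n → Bool) (y : Bool) (t : ℕ) : ℕ :=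
  (Finset.univ.filter fun j : Fin n => j.val < t ∧ f j = y).card

section rank

variable {n : ℕ} (f : Fin n → Bool) (y : Bool)

theorem rank_zero : rank f y 0 = 0 := by simp [rank]

theorem rank_mono {s t : ℕ} (h : s ≤ t) : rank f y s ≤ rank f y t :=
  Finset.card_le_card fun j hj => by
    simp only [Finset.mem_filter, Finset.mem_univ, true_and] at hj ⊢
    exact ⟨by omega, hj.2⟩

theorem rank_succ (i : Fin n) : rank f y (i + 1) = rank f y i + if f i = y then 1 else 0 := by
  unfold rank
  split_ifs with h
  · rw [← Finset.card_insert_of_notMem (a := i) (by simp)]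
    congr 1
    ext j
    simp only [Finset.mem_filter, Finset.mem_univ, true_and, Finset.mem_insert, Fin.ext_iff]
    constructor
    · rintro ⟨h1, h2⟩
      by_cases e : j.val = i.val
      · exact Or.inl e
      · exact Or.inr ⟨by omega, h2⟩
    · rintro (h1 | ⟨h1, h2⟩)
      · exact ⟨by omega, by rw [Fin.ext h1, h]⟩
      · exact ⟨by omega, h2⟩
  · rw [add_zero]
    congr 1
    ext j
    simp only [Finset.mem_filter, Finset.mem_univ, true_and]
    refine and_congr_left fun h2 => ⟨fun h1 => ?_, fun h1 => by omega⟩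
    have : j ≠ i := by rintro rfl; exact h h2
    have : j.val ≠ i.val := fun e => this (Fin.ext e)
    omega

variable {f y}

theorem rank_succ_of_eq {i : Fin n} (h : f i = y) : rank f y (i + 1) = rank f y i + 1 := by
  rw [rank_succ, if_pos h]

theorem rank_lt_rank {i : Fin n} {t : ℕ} (h : f i = y) (ht : i.val < t) :
    rank f y i < rank f y t := by
  have := rank_mono f y (show i.val + 1 ≤ t from ht)
  rw [rank_succ_of_eq h] at this
  omega

theorem eq_of_rank_eq {i j : Fin n} (hi : f i = y) (hj : f j = y) (h : rank f y i = rank f y j) :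
    i = j := by
  rcases lt_trichotomy i j with hl | hl | hl
  · exact absurd (rank_lt_rank hi hl) (by omega)
  · exact hl
  · exact absurd (rank_lt_rank hj hl) (by omega)

theorem exists_rank_eq {k t : ℕ} (ht : t ≤ n) (hk : k < rank f y t) :
    ∃ i : Fin n, f i = y ∧ rank f y i = k := by
  induction t with
  | zero => simp [rank_zero] at hk
  | succ t ih =>
    have e := rank_succ f y ⟨t, ht⟩
    simp only at e
    by_cases h : k < rank f y t
    · exact ih (by omega) h
    · split_ifs at e with hf
      · exact ⟨⟨t, ht⟩, hf, by simp only; omega⟩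
      · omega

theorem count_take_ofFn (f : Fin n → Bool) (y : Bool) {t : ℕ} (ht : t ≤ n) :
    ((List.ofFn f).take t).count y = rank f y t := by
  induction t with
  | zero => simp [rank_zero]
  | succ t ih =>
    have e := rank_succ f y ⟨t, ht⟩
    simp only at e
    rw [List.take_add_one, List.count_append, ih (by omega), e]
    simp [show t < n by omega, List.count_singleton]

theorem count_ofFn (f : Fin n → Bool) (y : Bool) : (List.ofFn f).count y = rank f y n := by
  rw [← count_take_ofFn f y le_rfl, List.take_of_length_le (by simp)]

theorem rank_false_add_rank_true (f : Fin n → Bool) {t : ℕ} (ht : t ≤ n) :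
    rank f false t + rank f true t = t := by
  rw [← count_take_ofFn f _ ht, ← count_take_ofFn f _ ht, List.count_false_add_count_true]
  simp [ht]

theorem occ_ofFn (f : Fin n → Bool) (x : Bool) (k : ℕ) :
    Occ x (List.ofFn f) k ↔ ∃ i, f i = x ∧ rank f (!x) i = k := by
  constructor
  · rintro ⟨u, v, h, hu⟩
    have hl := congrArg List.length h
    simp only [List.length_ofFn, List.length_append, List.length_cons] at hl
    refine ⟨⟨u.length, by omega⟩, ?_, ?_⟩
    · have := congrArg (·[u.length]?) h
      simpa [show u.length < n by omega] using this
    · rw [← count_take_ofFn _ _ (by simp only; omega), h]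
      simpa using hu
  · rintro ⟨i, hi, hk⟩
    refine ⟨(List.ofFn f).take i, (List.ofFn f).drop (i + 1), ?_, ?_⟩
    · conv_lhs => rw [← List.take_append_drop i (List.ofFn f)]
      rw [List.drop_eq_getElem_cons (by simp)]
      simp [hi]
    · rw [count_take_ofFn _ _ i.2.le, hk]

end rank

/-- The involution `σ` preserves the classes of `f` and reverses each of them. -/
def Compat {n : ℕ} (f : Fin n → Bool) (σ : Equiv.Perm (Fin n)) : Prop :=
  Function.Involutive σ ∧ (∀ i, f (σ i) = f i) ∧ ∀ i j, i < j → f i = f j → σ j < σ i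

section Compat

variable {n : ℕ} {f : Fin n → Bool} {σ τ : Equiv.Perm (Fin n)}

theorem Compat.rank_add (h : Compat f σ) {y : Bool} {i : Fin n} (hi : f i = y) :
    rank f y i + rank f y (σ i + 1) = rank f y n := by
  obtain ⟨hinv, hf, hanti⟩ := h
  have e1 : rank f y i = (Finset.univ.filter fun j : Fin n => σ i < j ∧ f j = y).card := by
    refine Finset.card_bij (fun j _ => σ j) ?_ (fun _ _ _ _ h => σ.injective h) ?_
    · intro j hj
      simp only [Finset.mem_filter, Finset.mem_univ, true_and] at hj ⊢
      exact ⟨hanti _ _ hj.1 (by rw [hj.2, hi]), by rw [hf, hj.2]⟩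
    · intro j hj
      simp only [Finset.mem_filter, Finset.mem_univ, true_and] at hj
      refine ⟨σ j, ?_, hinv j⟩
      simp only [Finset.mem_filter, Finset.mem_univ, true_and]
      have := hanti _ _ hj.1 (by rw [hf, hi, hj.2])
      rw [hinv] at this
      exact ⟨this, by rw [hf, hj.2]⟩
  rw [e1, rank, rank, ← Finset.card_union_of_disjoint]
  · congr 1
    ext j
    simp only [Finset.mem_union, Finset.mem_filter, Finset.mem_univ, true_and, j.2, Fin.lt_def]
    constructor
    · rintro (h | h) <;> exact h.2
    · intro h
      by_cases hc : (σ i).val < j.val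
      · exact Or.inl ⟨hc, h⟩
      · exact Or.inr ⟨by omega, h⟩
  · rw [Finset.disjoint_filter]
    rintro j - ⟨h1, -⟩ ⟨h2, -⟩
    rw [Fin.lt_def] at h1
    omega

theorem Compat.rank_apply (h : Compat f σ) {y : Bool} {i : Fin n} (hi : f i = y) :
    rank f y i + rank f y (σ i) + 1 = rank f y n := by
  have := h.rank_add hi
  rw [rank_succ_of_eq (by rw [h.2.1, hi])] at this
  omega

theorem Compat.unique (h : Compat f σ) (h' : Compat f τ) : σ = τ := by
  ext1 i
  have e1 := h.rank_apply (rfl : f i = f i)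
  have e2 := h'.rank_apply (rfl : f i = f i)
  exact eq_of_rank_eq (h.2.1 i) (h'.2.1 i) (by omega)

theorem exists_compat (f : Fin n → Bool) : ∃ σ, Compat f σ := by
  have h : ∀ i, ∃ j, f j = f i ∧ rank f (f i) i + rank f (f i) j + 1 = rank f (f i) n := by
    intro i
    have hi : rank f (f i) i < rank f (f i) n := rank_lt_rank rfl i.2
    obtain ⟨j, hj, hr⟩ := exists_rank_eq (f := f) (y := f i) le_rfl
      (show rank f (f i) n - 1 - rank f (f i) i < _ by omega)
    exact ⟨j, hj, by omega⟩
  choose s hs hr using h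
  have hinv : Function.Involutive s := by
    intro i
    have e1 := hr i
    have e2 := hr (s i)
    rw [hs] at e2
    exact eq_of_rank_eq (f := f) (y := f i) (by rw [hs, hs]) rfl (by omega)
  refine ⟨hinv.toPerm, hinv, hs, fun i j hij e => ?_⟩
  have e1 := hr i
  have e2 := hr j
  rw [← e] at e2
  have := rank_lt_rank (y := f i) rfl (show i.val < j.val from hij)
  by_contra hc
  have hc' : (s i).val ≤ (s j).val := not_lt.1 hc
  have := rank_mono f (f i) hc'
  omega

theorem Compat.apply_eq_self_iff (h : Compat f σ) {y : Bool} {i : Fin n} (hi : f i = y) :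
    σ i = i ↔ 2 * rank f y i + 1 = rank f y n := by
  have e := h.rank_apply hi
  constructor
  · intro hs
    rw [hs] at e
    omega
  · intro hr
    exact eq_of_rank_eq (by rw [h.2.1, hi]) hi (by omega)

theorem Compat.ncard_fixed (h : Compat f σ) (y : Bool) :
    {i | σ i = i ∧ f i = y}.ncard = rank f y n % 2 := by
  rcases Nat.mod_two_eq_zero_or_one (rank f y n) with hp | hp
  · rw [hp, Set.ncard_eq_zero]
    ext i
    simp only [Set.mem_ofPred_eq, Set.mem_empty_iff_false, iff_false]
    rintro ⟨h1, h2⟩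
    rw [h.apply_eq_self_iff h2] at h1
    omega
  · obtain ⟨i, hi, hr⟩ := exists_rank_eq (f := f) (y := y) le_rfl
      (show rank f y n / 2 < _ by omega)
    rw [hp, Set.ncard_eq_one]
    refine ⟨i, Set.ext fun j => ⟨?_, ?_⟩⟩
    · rintro ⟨h1, h2⟩
      rw [h.apply_eq_self_iff h2] at h1
      exact eq_of_rank_eq h2 hi (by omega)
    · rintro rfl
      exact ⟨(h.apply_eq_self_iff hi).2 (by omega), hi⟩

theorem Compat.fp_eq (h : Compat f σ) : fp σ = rank f false n % 2 + rank f true n % 2 := by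
  rw [← h.ncard_fixed, ← h.ncard_fixed, fp, ← Set.ncard_union_eq]
  · congr 1
    ext i
    cases hf : f i <;> simp [hf]
  · rw [Set.disjoint_left]
    rintro i ⟨-, h1⟩ ⟨-, h2⟩
    rw [h1] at h2
    cases h2

end Compat

end SimpleAvInv

namespace SimpleAvInv

section Skew

variable {n : ℕ} {f : Fin n → Bool} {σ : Equiv.Perm (Fin n)}

theorem indec_ofFn : Indec (List.ofFn f) ↔
    2 ≤ n ∧ ∀ t, 0 < t → t < n → rank f true t + rank f true (n - t) < rank f true n := by
  unfold Indec
  rw [List.length_ofFn, count_ofFn]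
  refine and_congr_right fun _ => forall_congr' fun t => forall_congr' fun h0 =>
    forall_congr' fun h1 => ?_
  rw [count_take_ofFn _ _ h1.le, count_take_ofFn _ _ (by omega)]

theorem indec_ofFn_false (h : Indec (List.ofFn f)) {t : ℕ} (h0 : 0 < t) (h1 : t < n) :
    rank f false n < rank f false t + rank f false (n - t) := by
  have := (indec_ofFn.1 h).2 t h0 h1
  have e1 := rank_false_add_rank_true f h1.le
  have e2 := rank_false_add_rank_true f (show n - t ≤ n by omega)
  have e3 := rank_false_add_rank_true f (le_refl n)
  omega

theorem card_le_of_lt_apply {i : Fin n} {l : ℕ} (h : ∀ j : Fin n, j.val < l → σ i < σ j) :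
    min l n + σ i < n := by
  have hc : (Finset.univ.filter fun j : Fin n => j.val < l).card ≤
      (Finset.univ.filter fun j : Fin n => σ i < j).card :=
    Finset.card_le_card_of_injOn σ (fun j hj => by simpa using h j (by simpa using hj))
      σ.injective.injOn
  rw [Fin.card_filter_val_lt, Finset.filter_lt_eq_Ioi, Fin.card_Ioi] at hc
  have := (σ i).2
  omega

theorem lt_card_of_apply_lt {i : Fin n} {l : ℕ} (h : ∀ j : Fin n, l ≤ j.val → σ j < σ i) :
    n ≤ l + σ i := by
  have hc : (Finset.univ.filter fun j : Fin n => ¬ j.val < l).card ≤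
      (Finset.univ.filter fun j : Fin n => j < σ i).card :=
    Finset.card_le_card_of_injOn σ (fun j hj => by simpa using h j (by simpa using hj))
      σ.injective.injOn
  have e := Finset.card_filter_add_card_filter_not (s := (Finset.univ : Finset (Fin n)))
    (fun j : Fin n => j.val < l)
  rw [Fin.card_filter_val_lt, Finset.card_univ, Fintype.card_fin] at e
  rw [Finset.filter_gt_eq_Iio, Fin.card_Iio] at hc
  omega

theorem IsLRMin.add_lt {i : Fin n} (h : IsLRMin σ i) : i.val + σ i < n := by
  have := card_le_of_lt_apply (σ := σ) (i := i) (l := i) h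
  omega

theorem IsRLMax.le_add {i : Fin n} (h : IsRLMax σ i) : n ≤ i.val + 1 + σ i :=
  lt_card_of_apply_lt (σ := σ) (i := i) (l := i.val + 1) h

theorem Compat.not_skew (hc : Compat f σ) (h : Indec (List.ofFn f)) {l : ℕ} (h0 : 0 < l)
    (h1 : l < n) (hs : ∀ i : Fin n, i.val < l → n - l ≤ σ i) : False := by
  have hlt := indec_ofFn_false h h0 h1
  have hle : rank f false (n - l) ≤
      (Finset.univ.filter fun j : Fin n => ¬ j.val < l ∧ f j = false).card := by
    refine Finset.card_le_card_of_injOn σ (fun j hj => ?_) σ.injective.injOn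
    simp only [Finset.coe_filter, Finset.mem_univ, true_and, Set.mem_ofPred_eq] at hj ⊢
    refine ⟨fun hlt => ?_, by rw [hc.2.1, hj.2]⟩
    have := hs _ hlt
    rw [hc.1 j] at this
    omega
  have e : rank f false l + (Finset.univ.filter fun j : Fin n => ¬ j.val < l ∧ f j = false).card =
      rank f false n := by
    unfold rank
    rw [← Finset.card_union_of_disjoint]
    · congr 1
      ext j
      simp only [Finset.mem_union, Finset.mem_filter, Finset.mem_univ, true_and, j.2]
      tauto
    · rw [Finset.disjoint_filter]
      tauto
  omega

theorem Compat.add_lt (hc : Compat f σ) (h : Indec (List.ofFn f)) {i : Fin n}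
    (hi : f i = false) : i.val + σ i + 1 < n := by
  have e := hc.rank_add hi
  by_contra hlt
  have h2 := (indec_ofFn.1 h).1
  rcases Nat.eq_zero_or_pos i.val with h0 | h0
  · have e1 := indec_ofFn_false h (show 0 < n - 1 by omega) (by omega)
    rw [show n - (n - 1) = i.val + 1 by omega, rank_succ_of_eq hi, h0, rank_zero] at e1
    have hs := rank_lt_rank (f := f) (i := σ i) (t := n) (by rw [hc.2.1, hi]) (σ i).2
    have := rank_mono f false (show n - 1 ≤ (σ i).val by omega)
    omega
  · have e1 := indec_ofFn_false h h0 i.2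
    have := rank_mono f false (show n - i.val ≤ (σ i).val + 1 by omega)
    omega

theorem Compat.lt_add (hc : Compat f σ) (h : Indec (List.ofFn f)) {i : Fin n}
    (hi : f i = true) : n ≤ i.val + σ i := by
  have e := hc.rank_add hi
  by_contra hlt
  have h2 := (indec_ofFn.1 h).1
  rcases Nat.eq_zero_or_pos i.val with h0 | h0
  · have e1 := (indec_ofFn.1 h).2 1 (by omega) (by omega)
    rw [show 1 = i.val + 1 by omega, rank_succ_of_eq hi, h0, rank_zero] at e1
    have := rank_mono f true (show (σ i).val + 1 ≤ n from (σ i).2)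
    rw [h0, rank_zero] at e
    have e2 := rank_succ f true (⟨n - 1, by omega⟩ : Fin n)
    simp only [show n - 1 + 1 = n by omega] at e2
    rw [show n - (0 + 1) = n - 1 by omega] at e1
    split_ifs at e2 <;> omega
  · have e1 := (indec_ofFn.1 h).2 _ h0 i.2
    have := rank_mono f true (show (σ i).val + 1 ≤ n - i.val by omega)
    omega

theorem Compat.isLRMin_iff (hc : Compat f σ) (h : Indec (List.ofFn f)) (i : Fin n) :
    IsLRMin σ i ↔ f i = false := by
  constructor
  · intro hi
    have := hi.add_lt
    by_contra hf
    have := hc.lt_add h (by simpa using hf)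
    omega
  · intro hi j hj
    cases hf : f j
    · exact hc.2.2 j i hj (by rw [hf, hi])
    · have e1 := hc.add_lt h hi
      have e2 := hc.lt_add h hf
      rw [Fin.lt_def] at hj ⊢
      omega

theorem Compat.isRLMax_iff (hc : Compat f σ) (h : Indec (List.ofFn f)) (i : Fin n) :
    IsRLMax σ i ↔ f i = true := by
  constructor
  · intro hi
    have := hi.le_add
    by_contra hf
    have := hc.add_lt h (by simpa using hf)
    omega
  · intro hi j hj
    cases hf : f j
    · have e1 := hc.lt_add h hi
      have e2 := hc.add_lt h hf
      rw [Fin.lt_def] at hj ⊢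
      omega
    · exact hc.2.2 i j hj (by rw [hf, hi])

theorem Compat.avoids123 (hc : Compat f σ) (h : Indec (List.ofFn f)) : Avoids123 σ := by
  rintro i j k hij hjk ⟨h1, h2⟩
  cases hf : f j
  · exact absurd ((hc.isLRMin_iff h j).2 hf i hij) h1.asymm
  · exact absurd ((hc.isRLMax_iff h j).2 hf k hjk) h2.asymm

theorem rank_eq_card (y : Bool) : rank f y n = {i | f i = y}.ncard := by
  rw [rank, ← Set.ncard_coe_finset]
  congr 1
  ext i
  simp

theorem Compat.lrmin_eq (hc : Compat f σ) (h : Indec (List.ofFn f)) :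
    lrmin σ = rank f false n := by
  simp only [rank_eq_card, lrmin, hc.isLRMin_iff h]

theorem Compat.rlmax_eq (hc : Compat f σ) (h : Indec (List.ofFn f)) :
    rlmax σ = rank f true n := by
  simp only [rank_eq_card, rlmax, hc.isRLMax_iff h]

theorem Compat.not_increasing_of_isInterval (hc : Compat f σ) (h : Indec (List.ofFn f))
    {I : Set (Fin n)} (hI : IsInterval σ I) (hu : I ≠ Set.univ) {i j : Fin n} (hi : i ∈ I)
    (hj : j ∈ I) (hij : i < j) : σ j < σ i := by
  have hav := hc.avoids123 h
  by_contra hlt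
  have hlt : σ i < σ j := lt_of_le_of_ne (not_lt.1 hlt) fun e => hij.ne (σ.injective e)
  obtain ⟨hO, hV⟩ := hI
  have hne : ∀ k, k ∉ I → ∀ m ∈ I, ∀ m' ∈ I, σ m ≤ σ k → σ k ≤ σ m' → False := by
    intro k hk m hm m' hm' h1 h2
    obtain ⟨k', hk', e⟩ := hV.out ⟨m, hm, rfl⟩ ⟨m', hm', rfl⟩ ⟨h1, h2⟩
    exact hk (σ.injective e ▸ hk')
  have hleft : ∀ k, k ∉ I → k < j → ∀ m ∈ I, k < m ∧ σ m < σ k := by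
    intro k hk hkj m hm
    have hki : k < i := by
      by_contra hc
      exact hk (hO.out hi hj ⟨not_lt.1 hc, hkj.le⟩)
    refine ⟨?_, ?_⟩
    · by_contra hc
      exact hk (hO.out hm hi ⟨not_lt.1 hc, hki.le⟩)
    · by_contra hc
      by_cases h' : σ k < σ i
      · exact hav k i j hki hij ⟨h', hlt⟩
      · exact hne k hk i hi m hm (not_lt.1 h') (not_lt.1 hc)
  have hright : ∀ k, k ∉ I → j < k → ∀ m ∈ I, m < k ∧ σ k < σ m := by
    intro k hk hkj m hm
    refine ⟨?_, ?_⟩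
    · by_contra hc
      exact hk (hO.out hj hm ⟨hkj.le, not_lt.1 hc⟩)
    · by_contra hc
      by_cases h' : σ j < σ k
      · exact hav i j k hij hkj ⟨hlt, h'⟩
      · exact hne k hk m hm j hj (not_lt.1 hc) (not_lt.1 h')
  have skew : ∀ l : ℕ, 0 < l → l < n → (∀ a b : Fin n, a.val < l → l ≤ b.val → σ b < σ a) →
      False := fun l h0 h1 hs => hc.not_skew h h0 h1 fun a ha => by
    have := lt_card_of_apply_lt (σ := σ) (i := a) (l := l) fun b hb => hs a b ha hb
    omega
  obtain ⟨k, hk⟩ := (Set.ne_univ_iff_exists_notMem I).1 hu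
  have hkj : k ≠ j := by rintro rfl; exact hk hj
  rcases lt_or_gt_of_ne hkj with hkj | hkj
  · obtain ⟨m, hm, hmin⟩ := Set.exists_min_image I id I.toFinite ⟨i, hi⟩
    refine skew m (by have := (hleft k hk hkj m hm).1; omega) m.2 fun a b ha hb => ?_
    have haI : a ∉ I := fun h => absurd (hmin a h) (not_le.2 ha)
    have haj : a < j := lt_of_lt_of_le ha (hmin j hj)
    by_cases hbI : b ∈ I
    · exact (hleft a haI haj b hbI).2
    · have hjb : j < b := by
        by_contra hc
        exact hbI (hO.out hm hj ⟨hb, not_lt.1 hc⟩)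
      exact ((hright b hbI hjb i hi).2).trans (hleft a haI haj i hi).2
  · obtain ⟨m, hm, hmax⟩ := Set.exists_max_image I id I.toFinite ⟨i, hi⟩
    refine skew (m + 1) (by omega) (by have := (hright k hk hkj m hm).1; omega)
      fun a b ha hb => ?_
    have hmb : m < b := by rw [Fin.lt_def]; omega
    have ham : a ≤ m := by rw [Fin.le_def]; omega
    have hbI : b ∉ I := fun h => absurd (hmax b h) (not_le.2 hmb)
    have hjb : j < b := lt_of_le_of_lt (hmax j hj) hmb
    by_cases haI : a ∈ I
    · exact (hright b hbI hjb a haI).2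
    · have haj : a < j := by
        by_contra hc
        exact haI (hO.out hj hm ⟨not_lt.1 hc, ham⟩)
      exact ((hright b hbI hjb i hi).2).trans (hleft a haI haj i hi).2

theorem exists_rank_of_reduced (h : ∀ y, Reduced (!y) (List.ofFn f)) {y : Bool} {k : ℕ}
    (h0 : 0 < k) (h1 : k < rank f y n) :
    ∃ i, f i = !y ∧ (rank f y i = k ∨ rank f y i = rank f y n - k) := by
  have := h y k h0 (by rwa [Bool.not_not, count_ofFn])
  rw [Bool.not_not, count_ofFn, occ_ofFn, occ_ofFn, Bool.not_not] at this
  rcases this with ⟨i, h2, h3⟩ | ⟨i, h2, h3⟩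
  · exact ⟨i, h2, Or.inl h3⟩
  · exact ⟨i, h2, Or.inr h3⟩

/-- If `a`, `b` are neighbours in one class, every index with the rank of `b` is in it. -/
theorem apply_eq_of_rank_eq {a b i : Fin n} {y : Bool} (hab : b.val = a.val + 1) (ha : f a = y)
    (hb : f b = y) (h : rank f y i = rank f y b) : f i = y := by
  have e1 := rank_succ_of_eq ha
  have e2 := rank_succ_of_eq hb
  rw [← hab] at e1
  suffices i = b by rw [this, hb]
  have h1 : ¬ i.val ≤ a.val := fun hc => by have := rank_mono f y hc; omega
  have h2 : ¬ b.val + 1 ≤ i.val := fun hc => by have := rank_mono f y hc; omega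
  exact Fin.ext (by omega)

theorem Compat.isSimple (hc : Compat f σ) (h : Indec (List.ofFn f))
    (hr : ∀ y, Reduced (!y) (List.ofFn f)) : IsSimple σ := by
  refine ⟨(indec_ofFn.1 h).1, fun I hI => ?_⟩
  by_contra hcon
  push Not at hcon
  obtain ⟨hs, hu⟩ := hcon
  have hanti : ∀ {i j}, i ∈ I → j ∈ I → i < j → σ j < σ i := fun hi hj =>
    hc.not_increasing_of_isInterval h hI hu hi hj
  obtain ⟨l, hl, m, hm, hlm⟩ : ∃ l ∈ I, ∃ m ∈ I, l < m := by
    obtain ⟨a, ha, b, hb, hab⟩ := hs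
    rcases lt_or_gt_of_ne hab with h | h
    · exact ⟨a, ha, b, hb, h⟩
    · exact ⟨b, hb, a, ha, h⟩
  obtain ⟨b, hb⟩ : ∃ b : Fin n, b.val = l.val + 1 := ⟨⟨l + 1, by omega⟩, rfl⟩
  have hbI : b ∈ I := hI.1.out hl hm ⟨by rw [Fin.le_def]; omega, by rw [Fin.le_def]; omega⟩
  have hlb : l < b := by rw [Fin.lt_def]; omega
  have hlt := hanti hl hbI hlb
  have hval : (σ l).val = (σ b).val + 1 := by
    obtain ⟨k, hk, e⟩ := hI.2.out ⟨b, hbI, rfl⟩ ⟨l, hl, rfl⟩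
      (show (⟨σ b + 1, by omega⟩ : Fin n) ∈ Set.Icc (σ b) (σ l) from
        ⟨by rw [Fin.le_def]; simp, by rw [Fin.le_def]; simp only; omega⟩)
    have e' : (σ k).val = σ b + 1 := by rw [e]
    rcases lt_trichotomy k l with h1 | h1 | h1
    · have := hanti hk hl h1
      omega
    · rw [← h1, e']
    · rcases lt_or_eq_of_le (show b ≤ k by rw [Fin.le_def]; omega) with h2 | h2
      · have := hanti hbI hk h2
        omega
      · rw [← h2] at e'
        omega
  have hsame : f b = f l → False := fun hfb => by
    have e1 := rank_succ_of_eq (f := f) (y := f l) (i := l) rfl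
    rw [← hb] at e1
    obtain ⟨i, hi, hk⟩ := exists_rank_of_reduced hr (y := f l) (k := rank f (f l) b) (by omega)
      (rank_lt_rank hfb b.2)
    have hy : f i = f l := by
      rcases hk with hk | hk
      · exact apply_eq_of_rank_eq hb rfl hfb hk
      · have e2 := hc.rank_apply (rfl : f l = f l)
        exact apply_eq_of_rank_eq hval (by rw [hc.2.1, hfb]) (hc.2.1 l) (by omega)
    rw [hi] at hy
    simp at hy
  cases hfl : f l <;> cases hfb : f b
  · exact hsame (hfb.trans hfl.symm)
  · have := hc.add_lt h hfl
    have := hc.lt_add h hfb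
    omega
  · have := hc.lt_add h hfl
    have := hc.add_lt h hfb
    omega
  · exact hsame (hfb.trans hfl.symm)

end Skew

end SimpleAvInv

namespace SimpleAvInv

section Word

variable {n : ℕ} {f : Fin n → Bool} {σ : Equiv.Perm (Fin n)}

theorem IsSimple.not_skew (h : IsSimple σ) (hn : 3 ≤ n) {l : ℕ} (h0 : 0 < l) (h1 : l < n)
    (hs : ∀ i : Fin n, i.val < l → n - l ≤ σ i) : False := by
  obtain ⟨-, h⟩ := h
  have him : σ '' {i | i.val < l} = {i | n - l ≤ i.val} := by
    refine Set.eq_of_subset_of_ncard_le ?_ ?_ (Set.toFinite _)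
    · rintro _ ⟨i, hi, rfl⟩
      exact hs i hi
    · rw [Set.ncard_image_of_injective _ σ.injective, Set.ncard_eq_toFinset_card',
        Set.ncard_eq_toFinset_card']
      have e1 : ({i : Fin n | n - l ≤ i.val} : Set (Fin n)).toFinset =
          Finset.univ.filter fun i : Fin n => ¬ i.val < n - l := by ext; simp
      have e2 : ({i : Fin n | i.val < l} : Set (Fin n)).toFinset =
          Finset.univ.filter fun i : Fin n => i.val < l := by ext; simp
      have e := Finset.card_filter_add_card_filter_not (s := (Finset.univ : Finset (Fin n)))
        (fun j : Fin n => j.val < n - l)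
      rw [Fin.card_filter_val_lt, Finset.card_univ, Fintype.card_fin] at e
      rw [e1, e2, Fin.card_filter_val_lt]
      omega
  have him' : σ '' {i | l ≤ i.val} = {i | i.val < n - l} := by
    have := congrArg compl him
    rw [← Set.image_compl_eq σ.bijective] at this
    convert this using 2
    · ext i
      simp
    · ext i
      simp
      omega
  have low : ∀ t, ({i : Fin n | i.val < t} : Set (Fin n)).OrdConnected := fun t =>
    ⟨fun a _ b hb c hc => lt_of_le_of_lt (Fin.le_def.1 hc.2) hb⟩
  have high : ∀ t, ({i : Fin n | t ≤ i.val} : Set (Fin n)).OrdConnected := fun t =>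
    ⟨fun a ha b _ c hc => le_trans ha (Fin.le_def.1 hc.1)⟩
  have a1 := h _ ⟨low l, him ▸ high _⟩
  have a2 := h _ ⟨high l, him' ▸ low _⟩
  have b1 : ({i : Fin n | i.val < l} : Set (Fin n)).Subsingleton := a1.resolve_right fun e =>
    absurd (e ▸ Set.mem_univ (⟨l, h1⟩ : Fin n) : (⟨l, h1⟩ : Fin n) ∈ {i : Fin n | i.val < l})
      (lt_irrefl l)
  have b2 : ({i : Fin n | l ≤ i.val} : Set (Fin n)).Subsingleton := a2.resolve_right fun e =>
    absurd (e ▸ Set.mem_univ (⟨0, h0.trans h1⟩ : Fin n) :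
      (⟨0, h0.trans h1⟩ : Fin n) ∈ {i : Fin n | l ≤ i.val}) (not_le.2 h0)
  have c1 : l ≤ 1 := by
    by_contra hc
    have := b1 (show (⟨0, by omega⟩ : Fin n) ∈ {i : Fin n | i.val < l} from h0)
      (show (⟨1, by omega⟩ : Fin n) ∈ {i : Fin n | i.val < l} from not_le.1 hc)
    simp [Fin.ext_iff] at this
  have := b2 (show (⟨n - 1, by omega⟩ : Fin n) ∈ {i : Fin n | l ≤ i.val} from
    show l ≤ n - 1 by omega) (show (⟨n - 2, by omega⟩ : Fin n) ∈ {i : Fin n | l ≤ i.val} from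
    show l ≤ n - 2 by omega)
  simp only [Fin.ext_iff] at this
  omega

/-- The letter at an index tells whether the entry is a left-to-right minimum. -/
noncomputable def letter (σ : Equiv.Perm (Fin n)) (i : Fin n) : Bool :=
  open Classical in !decide (IsLRMin σ i)

theorem letter_eq_false {i : Fin n} : letter σ i = false ↔ IsLRMin σ i := by
  simp [letter]

theorem letter_eq_true {i : Fin n} : letter σ i = true ↔ ¬ IsLRMin σ i := by
  simp [letter]

theorem isLRMin_apply (hinv : Function.Involutive σ) {i : Fin n} (h : IsLRMin σ i) :
    IsLRMin σ (σ i) := by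
  intro j hj
  rw [hinv i]
  by_contra hc
  rcases lt_or_eq_of_le (not_lt.1 hc) with h1 | h1
  · have := h _ h1
    rw [hinv j] at this
    exact hj.asymm this
  · rw [← h1, hinv j] at hj
    exact hj.ne rfl

theorem compat_letter (hinv : Function.Involutive σ) (hav : Avoids123 σ) :
    Compat (letter σ) σ := by
  refine ⟨hinv, fun i => ?_, fun i j hij e => ?_⟩
  · cases h : letter σ i
    · exact letter_eq_false.2 (isLRMin_apply hinv (letter_eq_false.1 h))
    · refine letter_eq_true.2 fun hc => letter_eq_true.1 h ?_
      have := isLRMin_apply hinv hc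
      rwa [hinv i] at this
  · cases h : letter σ j
    · exact letter_eq_false.1 h i hij
    · rw [h, letter_eq_true] at e
      simp only [IsLRMin] at e
      push Not at e
      obtain ⟨k, hk, hk'⟩ := e
      by_contra hc
      exact hav k i j hk hij ⟨lt_of_le_of_ne hk' fun e => hk.ne (σ.injective e),
        lt_of_le_of_ne (not_lt.1 hc) fun e => hij.ne (σ.injective e)⟩

theorem indec_letter (hinv : Function.Involutive σ) (hav : Avoids123 σ) (hs : IsSimple σ)
    (hn : 3 ≤ n) : Indec (List.ofFn (letter σ)) := by
  have hc := compat_letter hinv hav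
  refine indec_ofFn.2 ⟨by omega, fun t h0 h1 => ?_⟩
  by_contra hle
  have e1 := rank_false_add_rank_true (letter σ) h1.le
  have e2 := rank_false_add_rank_true (letter σ) (show n - t ≤ n by omega)
  have e3 := rank_false_add_rank_true (letter σ) (le_refl n)
  have hA : ∀ i : Fin n, i.val < t → letter σ i = false → n - t ≤ σ i := by
    intro i hi hf
    have r1 := hc.rank_add hf
    have r2 := rank_lt_rank hf hi
    by_contra hlt
    have := rank_mono (letter σ) false (show (σ i).val + 1 ≤ n - t by omega)
    omega
  refine hs.not_skew hn h0 h1 fun i hi => ?_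
  cases hf : letter σ i
  · exact hA i hi hf
  · have h := letter_eq_true.1 hf
    simp only [IsLRMin] at h
    push Not at h
    obtain ⟨k, hk, hk'⟩ := h
    have hk' : σ k < σ i := lt_of_le_of_ne hk' fun e => hk.ne (σ.injective e)
    cases hfk : letter σ k
    · exact (hA k (by omega) hfk).trans hk'.le
    · exact absurd (hc.2.2 k i hk (by rw [hf, hfk])) hk'.asymm

theorem ordConnected_pair {a b : Fin n} (h : b.val = a.val + 1) :
    ({a, b} : Set (Fin n)).OrdConnected := by
  refine ⟨?_⟩
  rintro c hc d hd x ⟨h1, h2⟩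
  rw [Fin.le_def] at h1 h2
  have hc' : a.val ≤ c.val := by rcases hc with rfl | rfl <;> omega
  have hd' : d.val ≤ b.val := by rcases hd with rfl | rfl <;> omega
  rcases Nat.lt_or_ge a.val x.val with hx | hx
  · exact Or.inr (Fin.ext (by omega))
  · exact Or.inl (Fin.ext (by omega))

theorem Compat.reduced (hc : Compat f σ) (hs : IsSimple σ) (hn : 3 ≤ n) (y : Bool) :
    Reduced (!y) (List.ofFn f) := by
  intro k h0 h1
  simp only [Bool.not_not, count_ofFn, occ_ofFn] at h1 ⊢
  by_contra hcon
  push Not at hcon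
  obtain ⟨hA, hB⟩ := hcon
  have next : ∀ {a b : Fin n} {k : ℕ}, f a = y → f b = y → rank f y b = rank f y a + 1 →
      (∀ i, f i = !y → rank f y i ≠ rank f y b) → b.val = a.val + 1 := by
    intro a b k ha hb hab hno
    have e1 := rank_succ_of_eq ha
    have h1 : ¬ b.val < a.val + 1 := fun h => by
      have := rank_mono f y (show b.val ≤ a.val by omega)
      omega
    by_contra hne
    have hlt : a.val + 1 < b.val := by omega
    set c : Fin n := ⟨a + 1, by omega⟩ with hcd
    have hcv : rank f y c = rank f y b := by rw [hcd, e1, hab]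
    have : f c = y := by
      by_contra hfc
      exact hno c (by cases h : f c <;> cases y <;> simp_all) hcv
    have := rank_lt_rank this (show c.val < b.val from hlt)
    omega
  obtain ⟨b, hb, hbk⟩ := exists_rank_eq (f := f) (y := y) le_rfl h1
  obtain ⟨a, ha, hak⟩ := exists_rank_eq (f := f) (y := y) le_rfl (show k - 1 < _ by omega)
  have r1 := hc.rank_apply ha
  have r2 := hc.rank_apply hb
  have n1 : b.val = a.val + 1 := next (k := k) ha hb (by omega) fun i hi e => hA i hi (by omega)
  have n2 : (σ a).val = (σ b).val + 1 := next (k := k) (by rw [hc.2.1, hb]) (by rw [hc.2.1, ha])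
    (by omega) fun i hi e => hB i hi (by omega)
  have hI : IsInterval σ {a, b} := by
    refine ⟨ordConnected_pair n1, ?_⟩
    rw [Set.image_pair, Set.pair_comm]
    exact ordConnected_pair n2
  rcases hs.2 _ hI with h | h
  · have := h (Set.mem_insert a _) (Set.mem_insert_of_mem a rfl)
    rw [this] at n1
    omega
  · have := congrArg Set.ncard h
    rw [Set.ncard_univ, Nat.card_eq_fintype_card, Fintype.card_fin] at this
    have h2 := Set.ncard_insert_le a {b}
    rw [Set.ncard_singleton] at h2
    omega

end Word

end SimpleAvInv

namespace SimpleAvInv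

section Bijection

variable {n : ℕ} {σ : Equiv.Perm (Fin n)}

/-- The word recording the positions of the left-to-right minima. -/
noncomputable def word (p : Σ n : ℕ, Equiv.Perm (Fin n)) : List Bool := List.ofFn (letter p.2)

theorem IsSimpleAvInv.compat (h : IsSimpleAvInv σ) : Compat (letter σ) σ :=
  compat_letter h.2.2.2 h.2.2.1

theorem IsSimpleAvInv.indec (h : IsSimpleAvInv σ) : Indec (List.ofFn (letter σ)) :=
  indec_letter h.2.2.2 h.2.2.1 h.2.1 (by have := h.1; omega)

theorem IsSimpleAvInv.lrmin_eq (h : IsSimpleAvInv σ) : lrmin σ = rank (letter σ) false n :=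
  h.compat.lrmin_eq h.indec

theorem IsSimpleAvInv.rlmax_eq (h : IsSimpleAvInv σ) : rlmax σ = rank (letter σ) true n :=
  h.compat.rlmax_eq h.indec

theorem IsSimpleAvInv.lrmin_add_rlmax (h : IsSimpleAvInv σ) : lrmin σ + rlmax σ = n := by
  rw [h.lrmin_eq, h.rlmax_eq, rank_false_add_rank_true _ le_rfl]

theorem IsSimpleAvInv.fp_eq (h : IsSimpleAvInv σ) : fp σ = lrmin σ % 2 + rlmax σ % 2 := by
  rw [h.lrmin_eq, h.rlmax_eq, h.compat.fp_eq]

theorem IsSimpleAvInv.simpleWord (h : IsSimpleAvInv σ) : SimpleWord (List.ofFn (letter σ)) :=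
  have hn : 3 ≤ n := by have := h.1; omega
  ⟨h.indec, h.compat.reduced h.2.1 hn true, h.compat.reduced h.2.1 hn false⟩

theorem word_injOn : Set.InjOn word {p | IsSimpleAvInv p.2} := by
  rintro ⟨n, σ⟩ hσ ⟨m, τ⟩ hτ h
  have hσ : IsSimpleAvInv σ := hσ
  have hτ : IsSimpleAvInv τ := hτ
  have hl := congrArg List.length h
  simp only [word, List.length_ofFn] at hl
  subst hl
  have e : letter σ = letter τ := List.ofFn_injective h
  have := hσ.compat
  rw [e] at this
  rw [this.unique hτ.compat]

theorem exists_word_eq {w : List Bool} (hw : SimpleWord w) (h4 : 4 ≤ w.length) :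
    ∃ p, IsSimpleAvInv p.2 ∧ word p = w := by
  obtain ⟨σ, hc⟩ := exists_compat w.get
  have e : List.ofFn w.get = w := List.ofFn_get w
  rw [← e] at hw
  obtain ⟨hi, h0, h1⟩ := hw
  refine ⟨⟨w.length, σ⟩, ⟨h4, hc.isSimple hi fun y => ?_, hc.avoids123 hi, hc.1⟩, ?_⟩
  · cases y
    · exact h1
    · exact h0
  · have : letter σ = w.get := by
      funext i
      cases hf : w.get i
      · rw [letter_eq_false, hc.isLRMin_iff hi, hf]
      · rw [letter_eq_true, hc.isLRMin_iff hi, hf, Bool.not_eq_false]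
    rw [word, this, e]

/-- The number of simple `123`-avoiding involutions with given statistics. -/
noncomputable def permNum (a b : ℕ) : ℕ :=
  {p : Σ n : ℕ, Equiv.Perm (Fin n) | IsSimpleAvInv p.2 ∧ lrmin p.2 = a ∧ rlmax p.2 = b}.ncard

theorem permNum_of_lt {a b : ℕ} (h : a + b < 4) : permNum a b = 0 := by
  rw [permNum]
  refine (congrArg Set.ncard (Set.eq_empty_of_forall_notMem ?_)).trans (Set.ncard_empty _)
  rintro p ⟨hs, ha, hb⟩
  have := hs.lrmin_add_rlmax
  have := hs.1
  omega

theorem permNum_of_le {a b : ℕ} (h : 4 ≤ a + b) : permNum a b = num SimpleWord a b := by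
  rw [permNum, num, ← Set.InjOn.ncard_image (f := word) (word_injOn.mono fun p hp => hp.1)]
  congr 1
  ext w
  rw [mem_wordSet]
  constructor
  · rintro ⟨p, ⟨hs, ha, hb⟩, rfl⟩
    exact ⟨hs.simpleWord, by rw [word, count_ofFn, ← hs.lrmin_eq, ha],
      by rw [word, count_ofFn, ← hs.rlmax_eq, hb]⟩
  · rintro ⟨hw, ha, hb⟩
    have hl := List.count_false_add_count_true w
    obtain ⟨p, hp, rfl⟩ := exists_word_eq hw (by omega)
    rw [word, count_ofFn] at ha hb
    exact ⟨p, ⟨hp, by rw [hp.lrmin_eq, ha], by rw [hp.rlmax_eq, hb]⟩, rfl⟩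

theorem simpleWord_of_length_lt {w : List Bool} (h : w.length < 4) :
    SimpleWord w ↔ w = [false, true] := by
  constructor
  · rintro ⟨hi, h0, h1⟩
    obtain ⟨z, rfl, -⟩ := indec_iff_ends.1 hi
    rcases z with _ | ⟨x, _ | ⟨y, z⟩⟩
    · rfl
    · exfalso
      cases x
      · have := h1 1 (by simp) (by simp)
        simp [occ_cons, occ_nil] at this
      · have := h0 1 (by simp) (by simp)
        simp [occ_cons, occ_nil] at this
    · simp at h
      omega
  · rintro rfl
    refine ⟨indec_iff_ends.2 ⟨[], rfl, ?_⟩, ?_, ?_⟩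
    · simp [Above]
    · intro k h0 h1
      simp at h1
      omega
    · intro k h0 h1
      simp at h1
      omega

theorem num_simpleWord_of_lt {a b : ℕ} (h : a + b < 4) :
    num SimpleWord a b = if a = 1 ∧ b = 1 then 1 else 0 := by
  have e : wordSet SimpleWord a b = if a = 1 ∧ b = 1 then {[false, true]} else ∅ := by
    ext w
    rw [mem_wordSet]
    constructor
    · rintro ⟨hw, ha, hb⟩
      have hl := List.count_false_add_count_true w
      rw [simpleWord_of_length_lt (by omega)] at hw
      subst hw
      simp at ha hb
      simp [← ha, ← hb]
    · intro hw
      split_ifs at hw with hab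
      · rw [Set.mem_singleton_iff] at hw
        subst hw
        exact ⟨(simpleWord_of_length_lt (by simp)).2 rfl, by simp [hab.1], by simp [hab.2]⟩
      · exact absurd hw (Set.notMem_empty _)
  rw [num, e]
  split_ifs <;> simp

end Bijection

section Families

open MvPowerSeries

theorem bivGF_eq (S : Set (Σ n : ℕ, Equiv.Perm (Fin n))) : bivGF S =
    mk2 fun a b => (({p | p ∈ S ∧ lrmin p.2 = a ∧ rlmax p.2 = b}.ncard : ℕ) : ℚ) := rfl

theorem ncard_of_iff {S : Set (Σ n : ℕ, Equiv.Perm (Fin n))} {P : ℕ → ℕ → Prop}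
    [∀ a b, Decidable (P a b)]
    (h : ∀ p, p ∈ S ↔ IsSimpleAvInv p.2 ∧ P (lrmin p.2) (rlmax p.2)) (a b : ℕ) :
    {p | p ∈ S ∧ lrmin p.2 = a ∧ rlmax p.2 = b}.ncard = if P a b then permNum a b else 0 := by
  split_ifs with hP
  · rw [permNum]
    congr 1
    ext p
    simp only [Set.mem_ofPred_eq, h]
    constructor
    · rintro ⟨⟨h1, -⟩, h2⟩
      exact ⟨h1, h2⟩
    · rintro ⟨h1, rfl, rfl⟩
      exact ⟨⟨h1, hP⟩, rfl, rfl⟩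
  · refine (congrArg Set.ncard (Set.eq_empty_of_forall_notMem ?_)).trans (Set.ncard_empty _)
    rintro p ⟨h1, rfl, rfl⟩
    exact hP ((h p).1 h1).2

theorem mem_family {i : ℕ} (p : Σ n : ℕ, Equiv.Perm (Fin n)) :
    p ∈ family i ↔ IsSimpleAvInv p.2 ∧ lrmin p.2 % 2 + rlmax p.2 % 2 = i :=
  and_congr_right fun h => by rw [h.fp_eq]

theorem forall_fixed_letter_iff {n : ℕ} {σ : Equiv.Perm (Fin n)} (h : IsSimpleAvInv σ) (y : Bool) :
    (∀ i, σ i = i → letter σ i = !y) ↔ rank (letter σ) y n % 2 = 0 := by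
  rw [← h.compat.ncard_fixed, Set.ncard_eq_zero, Set.eq_empty_iff_forall_notMem]
  refine forall_congr' fun i => ?_
  cases hl : letter σ i <;> cases y <;> simp [hl]

theorem mem_familyRL (p : Σ n : ℕ, Equiv.Perm (Fin n)) :
    p ∈ familyRL ↔ IsSimpleAvInv p.2 ∧ (lrmin p.2 % 2 = 0 ∧ rlmax p.2 % 2 = 1) := by
  have e (h : IsSimpleAvInv p.2) :
      (∀ i, p.2 i = i → IsRLMax p.2 i) ↔ lrmin p.2 % 2 = 0 := by
    rw [h.lrmin_eq, ← forall_fixed_letter_iff h]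
    simp only [h.compat.isRLMax_iff h.indec, Bool.not_false]
  change (p ∈ family 1 ∧ _) ↔ _
  rw [mem_family]
  constructor
  · rintro ⟨⟨h, h1⟩, h2⟩
    rw [e h] at h2
    exact ⟨h, h2, by omega⟩
  · rintro ⟨h, h1, h2⟩
    exact ⟨⟨h, by omega⟩, (e h).2 h1⟩

theorem mem_familyLR (p : Σ n : ℕ, Equiv.Perm (Fin n)) :
    p ∈ familyLR ↔ IsSimpleAvInv p.2 ∧ (lrmin p.2 % 2 = 1 ∧ rlmax p.2 % 2 = 0) := by
  have e (h : IsSimpleAvInv p.2) :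
      (∀ i, p.2 i = i → IsLRMin p.2 i) ↔ rlmax p.2 % 2 = 0 := by
    rw [h.rlmax_eq, ← forall_fixed_letter_iff h]
    simp only [h.compat.isLRMin_iff h.indec, Bool.not_true]
  change (p ∈ family 1 ∧ _) ↔ _
  rw [mem_family]
  constructor
  · rintro ⟨⟨h, h1⟩, h2⟩
    rw [e h] at h2
    exact ⟨h, by omega, h2⟩
  · rintro ⟨h, h1, h2⟩
    exact ⟨⟨h, by omega⟩, (e h).2 h2⟩

theorem permNum_eq {a b : ℕ} (h : ¬ (a = 1 ∧ b = 1)) : permNum a b = num SimpleWord a b := by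
  rcases Nat.lt_or_ge (a + b) 4 with hl | hl
  · rw [permNum_of_lt hl, num_simpleWord_of_lt hl, if_neg h]
  · exact permNum_of_le hl

theorem bivGF_family_zero : bivGF (family 0) = wordGF 2 2 := by
  rw [bivGF_eq]
  refine mk2_congr fun a b => ?_
  rw [ncard_of_iff (P := fun a b => a % 2 + b % 2 = 0) mem_family]
  split_ifs <;> first | (exfalso; omega) | rw [permNum_eq (by omega)] | simp

theorem bivGF_familyRL : bivGF familyRL = wordGF 2 1 := by
  rw [bivGF_eq]
  refine mk2_congr fun a b => ?_
  rw [ncard_of_iff (P := fun a b => a % 2 = 0 ∧ b % 2 = 1) mem_familyRL]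
  split_ifs <;> first | rw [permNum_eq (by omega)] | simp

theorem bivGF_familyLR : bivGF familyLR = wordGF 1 2 := by
  rw [bivGF_eq]
  refine mk2_congr fun a b => ?_
  rw [ncard_of_iff (P := fun a b => a % 2 = 1 ∧ b % 2 = 0) mem_familyLR]
  split_ifs <;> first | rw [permNum_eq (by omega)] | simp

theorem bivGF_family_one : bivGF (family 1) = bivGF familyRL + bivGF familyLR := by
  rw [bivGF_eq, bivGF_eq, bivGF_eq, mk2_add]
  refine mk2_congr fun a b => ?_
  rw [ncard_of_iff (P := fun a b => a % 2 + b % 2 = 1) mem_family,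
    ncard_of_iff (P := fun a b => a % 2 = 0 ∧ b % 2 = 1) mem_familyRL,
    ncard_of_iff (P := fun a b => a % 2 = 1 ∧ b % 2 = 0) mem_familyLR]
  split_ifs <;> first | omega | simp

theorem bivGF_family_two : bivGF (family 2) = wordGF 1 1 - X 0 * X 1 := by
  have e : (X 0 * X 1 : MvPowerSeries (Fin 2) ℚ) =
      mk2 fun a b => if a = 1 ∧ b = 1 then 1 else 0 := by
    rw [← mul_one (X 1), one_eq_mk2, X_one_mul_mk2, X_zero_mul_mk2]
    refine mk2_congr fun a b => ?_
    split_ifs <;> first | rfl | omega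
  rw [bivGF_eq, e, wordGF, mk2_sub]
  refine mk2_congr fun a b => ?_
  rw [ncard_of_iff (P := fun a b => a % 2 + b % 2 = 2) mem_family]
  by_cases h : a = 1 ∧ b = 1
  · obtain ⟨rfl, rfl⟩ := h
    simp [permNum_of_lt, num_simpleWord_of_lt]
  · rw [if_neg h, sub_zero, permNum_eq h]
    split_ifs <;> first | omega | simp

theorem diag_bivGF_family (i : ℕ) : diag (bivGF (family i)) = lengthGF i := by
  classical
  rw [bivGF_eq, diag_mk2]
  refine PowerSeries.ext fun n => ?_
  rw [lengthGF, PowerSeries.coeff_mk, PowerSeries.coeff_mk]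
  set S : Set (Equiv.Perm (Fin n)) := {σ | IsSimpleAvInv σ ∧ fp σ = i}
  rw [Set.ncard_eq_toFinset_card' S, Finset.card_eq_sum_card_fiberwise
    (f := fun σ => (lrmin σ, rlmax σ)) (t := Finset.HasAntidiagonal.antidiagonal n)]
  · push_cast
    refine Finset.sum_congr rfl fun c hc => ?_
    congr 1
    rw [← Set.ncard_coe_finset, ← Set.ncard_image_of_injective _
      (sigma_mk_injective (β := fun n => Equiv.Perm (Fin n)) (i := n))]
    congr 1
    ext ⟨m, σ⟩
    constructor
    · rintro ⟨⟨h1, h2⟩, h3, h4⟩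
      have h1 : IsSimpleAvInv σ := h1
      have h3 : lrmin σ = c.1 := h3
      have h4 : rlmax σ = c.2 := h4
      have := h1.lrmin_add_rlmax
      rw [Finset.HasAntidiagonal.mem_antidiagonal] at hc
      obtain rfl : m = n := by omega
      refine ⟨σ, ?_, rfl⟩
      simp only [Finset.coe_filter, Set.mem_toFinset, Set.mem_ofPred_eq]
      exact ⟨⟨h1, h2⟩, Prod.ext h3 h4⟩
    · rintro ⟨τ, hτ, h⟩
      simp only [Finset.coe_filter, Set.mem_toFinset, Set.mem_ofPred_eq] at hτ
      rw [← h]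
      exact ⟨hτ.1, congrArg Prod.fst hτ.2, congrArg Prod.snd hτ.2⟩
  · intro σ hσ
    simp only [Set.coe_toFinset] at hσ
    exact Finset.HasAntidiagonal.mem_antidiagonal.2 hσ.1.lrmin_add_rlmax

end Families

end SimpleAvInv

theorem mainTheorem8 :
    (∃ (x r : PowerSeries ℚ), x = PowerSeries.X ∧
      PowerSeries.constantCoeff r = 1 ∧ r ^ 2 = 1 - 2 * x ^ 2 - 3 * x ^ 4 ∧
      SimpleAvInv.lengthGF 0 =
        2 * x ^ 6 * (1 + x ^ 2 - r) *
          (2 - 2 * x ^ 2 - 10 * x ^ 4 - 6 * x ^ 6 + (2 - 6 * x ^ 4 - 4 * x ^ 6) * r)⁻¹ ∧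
      SimpleAvInv.lengthGF 1 =
        2 * x ^ 5 * (1 + x ^ 2 + r) *
          ((1 + x ^ 2) ^ 2 * (1 - 3 * x ^ 2 + (1 - 2 * x ^ 2) * r))⁻¹ ∧
      SimpleAvInv.lengthGF 2 =
        x ^ 4 * (2 + 5 * x ^ 2 + 3 * x ^ 4 - (2 + x ^ 2) * r) *
          (1 - x ^ 2 - 5 * x ^ 4 - 3 * x ^ 6 + (1 + 2 * x ^ 2 + x ^ 4) * r)⁻¹) ∧
    (∃ (u v r : MvPowerSeries (Fin 2) ℚ), u = MvPowerSeries.X 0 ∧ v = MvPowerSeries.X 1 ∧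
      MvPowerSeries.constantCoeff r = 1 ∧
      r ^ 2 = 1 - 6 * u ^ 2 * v ^ 2 - 4 * u ^ 2 * v ^ 4 - 4 * u ^ 4 * v ^ 2
        - 3 * u ^ 4 * v ^ 4 ∧
      SimpleAvInv.bivGF (SimpleAvInv.family 0) =
        2 * u ^ 2 * v ^ 4 * (1 + u ^ 2) * (1 + 2 * u ^ 2 + u ^ 2 * v ^ 2 - r) *
          ((1 - u ^ 2 * v ^ 2 + r) *
            (1 - 6 * u ^ 2 * v ^ 2 - 4 * u ^ 2 * v ^ 4 - 4 * u ^ 4 * v ^ 2 - 3 * u ^ 4 * v ^ 4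
              + (1 + 2 * v ^ 2 + u ^ 2 * v ^ 2) * r))⁻¹ ∧
      SimpleAvInv.bivGF SimpleAvInv.familyRL =
        u ^ 2 * v ^ 3 * (1 + u ^ 2) * (1 + 2 * v ^ 2 + u ^ 2 * v ^ 2 + r) *
          ((1 + v ^ 2) *
            (1 - 6 * u ^ 2 * v ^ 2 - 4 * u ^ 2 * v ^ 4 - 4 * u ^ 4 * v ^ 2 - 3 * u ^ 4 * v ^ 4
              + (1 - 3 * u ^ 2 * v ^ 2 - 2 * u ^ 4 * v ^ 2) * r))⁻¹ ∧
      SimpleAvInv.bivGF SimpleAvInv.familyLR =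
        v ^ 2 * u ^ 3 * (1 + v ^ 2) * (1 + 2 * u ^ 2 + v ^ 2 * u ^ 2 + r) *
          ((1 + u ^ 2) *
            (1 - 6 * v ^ 2 * u ^ 2 - 4 * v ^ 2 * u ^ 4 - 4 * v ^ 4 * u ^ 2 - 3 * v ^ 4 * u ^ 4
              + (1 - 3 * v ^ 2 * u ^ 2 - 2 * v ^ 4 * u ^ 2) * r))⁻¹ ∧
      SimpleAvInv.bivGF (SimpleAvInv.family 1) =
        SimpleAvInv.bivGF SimpleAvInv.familyRL + SimpleAvInv.bivGF SimpleAvInv.familyLR ∧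
      SimpleAvInv.bivGF (SimpleAvInv.family 2) =
        u * v ^ 3 *
          (2 + 7 * u ^ 2 + 4 * u ^ 2 * v ^ 2 + 4 * u ^ 4 + 3 * u ^ 4 * v ^ 2
            - (2 + u ^ 2) * r) *
          (1 - 6 * u ^ 2 * v ^ 2 - 4 * u ^ 2 * v ^ 4 - 4 * u ^ 4 * v ^ 2 - 3 * u ^ 4 * v ^ 4
            + (1 + 2 * v ^ 2 + u ^ 2 * v ^ 2) * r)⁻¹) := by
  refine ⟨?_, ?_⟩
  · obtain ⟨q, hq, hq2, h0, h1, h2⟩ := SimpleAvInv.diag_closed_forms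
    refine ⟨PowerSeries.X, q, rfl, hq, hq2, ?_, ?_, ?_⟩
    · rw [← SimpleAvInv.diag_bivGF_family, SimpleAvInv.bivGF_family_zero, h0]
    · rw [← SimpleAvInv.diag_bivGF_family, SimpleAvInv.bivGF_family_one, map_add,
        SimpleAvInv.bivGF_familyRL, SimpleAvInv.bivGF_familyLR, h1]
    · rw [← SimpleAvInv.diag_bivGF_family, SimpleAvInv.bivGF_family_two, h2]
  · obtain ⟨r, hr, hr2, h22, h21, h12, h11⟩ := SimpleAvInv.closed_forms
    exact ⟨MvPowerSeries.X 0, MvPowerSeries.X 1, r, rfl, rfl, hr, hr2,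
      SimpleAvInv.bivGF_family_zero.trans h22, SimpleAvInv.bivGF_familyRL.trans h21,
      SimpleAvInv.bivGF_familyLR.trans h12, SimpleAvInv.bivGF_family_one,
      SimpleAvInv.bivGF_family_two.trans h11⟩
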